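/- Let $M$ be a smooth (Hausdorff, finite-dimensional) manifold with a smooth linear connection $\nabla$, and let $A$ be a smooth nondegenerate $(2,0)$-tensor field on $M$, i.e. a smooth field of nondegenerate bilinear forms $A_x:T_xM\times T_xM\to\mathbb R$. Let $\pi:TM\to M$ be the projection. For $u\in TM$ and $v\in T_{\pi(u)}M$ let $v^{v}=\frac{d}{dt}\big|_{t=0}(u+tv)\in T_u(TM)$ be the vertical lift of $v$ at $u$. Let $\mathcal HM\subset T(TM)$ be the horizontal distribution of $\nabla$, whose fibre at $u$ consists of the initial velocities of the parallel transports of $u$ along smooth curves in $M$ starting at $\pi(u)$; the horizontal lift $v^{h}\in\mathcal H_uM$ of $v$ at $u$ is the element with $d\pi(v^h)=v$. There is exactly one $2$-form $\Omega$ on $TM$ (a field of alternating bilinear forms on the tangent spaces of $TM$) with $$\Omega(X^v,Y^v)=0,\quad \Omega(X^h,Y^h)=0,\quad \Omega(X^v,Y^h)=A(X,Y)\circ\pi,\quad \Omega(X^h,Y^v)=-A(Y,X)\circ\pi$$ for all vector fields $X,Y$ on $M$; it is called the lift of $(\nabla,0,0,A)$. Let $\lambda$ be the Liouville $1$-form on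 $T^*M$, $\lambda_\alpha(\xi)=\alpha(d\pi_{T^*M}(\xi))$, where $\pi_{T^*M}:T^*M\to M$ is the projection, and let $A^\flat:TM\to T^*M$, $A^\flat(u)=A(u,\cdot)$. Then the following assertions are equivalent: 1. $(A,\nabla)$ satisfies the Codazzi equation $$(\nabla_XA)(Z,Y)-(\nabla_YA)(Z,X)=A(Z,\tau(X,Y))$$ for all smooth vector fields $X,Y,Z$ on $M$, where $\tau(X,Y)=[X,Y]-\nabla_XY+\nabla_YX$; 2. $\Omega=(A^\flat)^*(d\lambda)$; 3. $\Omega$ is symplectic (smooth, closed and nondegenerate); 4. the distribution $(A^\flat)_*(\mathcal HM)$ on $T^*M$, the image of $\mathcal HM$ under the differential of $A^\flat$, is Lagrangian for $d\lambda$, i.e. each of its fibres is equal to its own $d\lambda$-orthogonal. -/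

import Mathlib

open Bundle Set
open scoped Manifold ContDiff Topology

noncomputable section

/-! ### Differential forms on manifolds -/

section Forms

variable {V : Type*} [NormedAddCommGroup V] [NormedSpace ℝ V]
  {H : Type*} [TopologicalSpace H] (J : ModelWithCorners ℝ V H)
  {N : Type*} [TopologicalSpace N] [ChartedSpace H N]
  {V' : Type*} [NormedAddCommGroup V'] [NormedSpace ℝ V']
  {H' : Type*} [TopologicalSpace H'] (J' : ModelWithCorners ℝ V' H')
  {N' : Type*} [TopologicalSpace N'] [ChartedSpace H' N']

/-- A (not necessarily smooth) differential `k`-form on the manifold `N`. -/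
abbrev DiffForm (N : Type*) [TopologicalSpace N] [ChartedSpace H N] (k : ℕ) : Type _ :=
  (p : N) → TangentSpace J p [⋀^Fin k]→L[ℝ] ℝ

variable {J}

/-- The expression of the form `θ` in the preferred chart at `p`, i.e. the pullback of `θ` under
the inverse of this chart; it is meaningful on the target of the chart. -/
def DiffForm.inChart {k : ℕ} (θ : DiffForm J N k) (p : N) : V → V [⋀^Fin k]→L[ℝ] ℝ := fun y =>
  (θ ((extChartAt J p).symm y)).compContinuousLinearMap
    (mfderivWithin 𝓘(ℝ, V) J (extChartAt J p).symm (range J) y :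
      V →L[ℝ] TangentSpace J ((extChartAt J p).symm y))

/-- A form is smooth if its expressions in charts are smooth. -/
def DiffForm.IsSmooth {k : ℕ} (θ : DiffForm J N k) : Prop :=
  ∀ p : N, ContDiffOn ℝ ∞ (θ.inChart p) (extChartAt J p).target

/-- The exterior derivative of a form on a manifold: at `p`, take the exterior derivative of the
expression of the form in the chart at `p`, and transport it back by the chart. -/
def DiffForm.d {k : ℕ} (θ : DiffForm J N k) : DiffForm J N (k + 1) := fun p =>
  (extDerivWithin (θ.inChart p) (range J) (extChartAt J p p)).compContinuousLinearMap
    (mfderiv J 𝓘(ℝ, V) (extChartAt J p) p : TangentSpace J p →L[ℝ] V)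

variable (J) in
/-- The pullback `f^* θ` of a form under a map `f`. -/
def DiffForm.pullback {k : ℕ} (f : N → N') (θ : DiffForm J' N' k) : DiffForm J N k := fun p =>
  (θ (f p)).compContinuousLinearMap (mfderiv J J' f p)

/-- A symplectic form: a smooth, closed, nondegenerate `2`-form. -/
structure DiffForm.IsSymplectic (θ : DiffForm J N 2) : Prop where
  smooth : θ.IsSmooth
  closed : θ.d = 0
  nondegenerate : ∀ (p : N) (ξ : TangentSpace J p), (∀ η, θ p ![ξ, η] = 0) → ξ = 0

/-- A distribution `D` on `N`, given as a subset of `TN`, is Lagrangian for the `2`-form `θ` if at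
each point its fibre is equal to its own `θ`-orthogonal. -/
def DiffForm.IsLagrangian (θ : DiffForm J N 2) (D : Set (TangentBundle J N)) : Prop :=
  ∀ (p : N) (ξ : TangentSpace J p),
    (⟨p, ξ⟩ : TangentBundle J N) ∈ D ↔
      ∀ η : TangentSpace J p, (⟨p, η⟩ : TangentBundle J N) ∈ D → θ p ![ξ, η] = 0

end Forms

/-! ### Connections, horizontal distributions and lifts -/

section Lift

variable {E : Type*} [NormedAddCommGroup E] [NormedSpace ℝ E]
  {M : Type*} [TopologicalSpace M] [ChartedSpace E M]

/-- A vector field `X` on `M` is smooth. -/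
def SmoothVectorField [IsManifold 𝓘(ℝ, E) ∞ M] (X : (x : M) → TangentSpace 𝓘(ℝ, E) x) : Prop :=
  ContMDiff 𝓘(ℝ, E) 𝓘(ℝ, E).tangent ∞ (fun x => (⟨x, X x⟩ : TangentBundle 𝓘(ℝ, E) M))

variable (E M) in
/-- A (not necessarily smooth) `(2,0)`-tensor field on `M`: a bilinear form on each tangent
space. -/
abbrev Tensor20 : Type _ :=
  (x : M) → TangentSpace 𝓘(ℝ, E) x →L[ℝ] TangentSpace 𝓘(ℝ, E) x →L[ℝ] ℝ

/-- The `(2,0)`-tensor field `A` is smooth. -/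
def Tensor20.IsSmooth [IsManifold 𝓘(ℝ, E) ∞ M] (A : Tensor20 E M) : Prop :=
  ContMDiff 𝓘(ℝ, E) (𝓘(ℝ, E).prod 𝓘(ℝ, E →L[ℝ] E →L[ℝ] ℝ)) ∞
    (fun x => TotalSpace.mk' (E →L[ℝ] E →L[ℝ] ℝ)
      (E := fun x : M => TangentSpace 𝓘(ℝ, E) x →L[ℝ] TangentSpace 𝓘(ℝ, E) x →L[ℝ] ℝ) x (A x))

/-- The `(2,0)`-tensor field `A` is nondegenerate, i.e. `u ↦ A(u, ·)` is injective on each tangent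
space. -/
def Tensor20.Nondegenerate (A : Tensor20 E M) : Prop :=
  ∀ (x : M) (u : TangentSpace 𝓘(ℝ, E) x), (∀ v, A x u v = 0) → u = 0

variable (E M) in
/-- The cotangent bundle `T^*M`. -/
abbrev CotangentBundle : Type _ :=
  TotalSpace (E →L[ℝ] ℝ) (fun x : M => TangentSpace 𝓘(ℝ, E) x →L[ℝ] ℝ)

/-- The map `A^♭ : TM → T^*M`, `u ↦ A(u, ·)`. -/
def Tensor20.flat (A : Tensor20 E M) (u : TangentBundle 𝓘(ℝ, E) M) : CotangentBundle E M :=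
  ⟨u.proj, A u.proj u.2⟩

variable [IsManifold 𝓘(ℝ, E) ∞ M]

variable (E M) in
/-- The Liouville `1`-form on `T^*M`: `λ_α(ξ) = α(dπ(ξ))`, with `π : T^*M → M`. -/
def liouville : DiffForm (𝓘(ℝ, E).prod 𝓘(ℝ, E →L[ℝ] ℝ)) (CotangentBundle E M) 1 := fun α =>
  ContinuousAlternatingMap.ofSubsingleton ℝ _ ℝ (0 : Fin 1)
    (α.2 ∘L mfderiv (𝓘(ℝ, E).prod 𝓘(ℝ, E →L[ℝ] ℝ)) 𝓘(ℝ, E)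
      (fun β : CotangentBundle E M => β.proj) α)

/-- The differential at `u` of the projection `π : TM → M`. -/
def dproj (u : TangentBundle 𝓘(ℝ, E) M) :
    TangentSpace 𝓘(ℝ, E).tangent u →L[ℝ] TangentSpace 𝓘(ℝ, E) u.proj :=
  mfderiv 𝓘(ℝ, E).tangent 𝓘(ℝ, E) (fun w : TangentBundle 𝓘(ℝ, E) M => w.proj) u

/-- The vertical lift at `u ∈ T_xM` of `v ∈ T_xM`: the tangent vector at `0` of the curve
`t ↦ u + t v`, written as the differential at `u` of the inclusion `T_xM → TM`, applied to `v`. -/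
def vertLift (u : TangentBundle 𝓘(ℝ, E) M) :
    TangentSpace 𝓘(ℝ, E) u.proj →L[ℝ] TangentSpace 𝓘(ℝ, E).tangent u :=
  mfderiv 𝓘(ℝ, E) 𝓘(ℝ, E).tangent (fun w : E => (⟨u.proj, w⟩ : TangentBundle 𝓘(ℝ, E) M)) u.2

/-- The velocity at time `t` of a curve in the manifold `N`, as a point of `TN`. -/
def velocity {V H N : Type*} [NormedAddCommGroup V] [NormedSpace ℝ V] [TopologicalSpace H]
    (J : ModelWithCorners ℝ V H) [TopologicalSpace N] [ChartedSpace H N]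
    (γ : ℝ → N) (t : ℝ) : TangentBundle J N :=
  ⟨γ t, mfderiv 𝓘(ℝ, ℝ) J γ t (1 : ℝ)⟩

/-- A linear connection on `M`, with Mathlib's convention `(∇_X Y)(x) = ∇ Y x (X x)`. -/
abbrev LinearConnection (E M : Type*) [NormedAddCommGroup E] [NormedSpace ℝ E]
    [TopologicalSpace M] [ChartedSpace E M] [IsManifold 𝓘(ℝ, E) ∞ M] : Type _ :=
  CovariantDerivative 𝓘(ℝ, E) E (TangentSpace 𝓘(ℝ, E) : M → Type _)

namespace LinearConnection

variable (nabla : LinearConnection E M)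

/-- The covariant derivative `∇_{c'} γ` at time `t` of a vector field `γ` along the curve
`c = π ∘ γ`. In the coordinates at `c t` it is given by the usual formula
`(γ^k)' + Γ_{ij}^k (c^i)' γ^j`: the second term is the derivative along `c'(t)` of the local
extension of `γ t` with constant coordinates. -/
def derivAlong (γ : ℝ → TangentBundle 𝓘(ℝ, E) M) (t : ℝ) : TangentSpace 𝓘(ℝ, E) (γ t).proj :=
  (show TangentSpace 𝓘(ℝ, E) (γ t).proj from
    deriv (F := E) (fun s => (trivializationAt E (TangentSpace 𝓘(ℝ, E)) (γ t).proj (γ s)).2) t) +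
    nabla (FiberBundle.extend E (γ t).2) (γ t).proj
      (velocity 𝓘(ℝ, E) (fun s => (γ s).proj) t).2

/-- The horizontal distribution `HM ⊆ T(TM)`: the initial velocities of the parallel transports
of vectors `u ∈ TM` along smooth curves in `M`. -/
def horizontal : Set (TangentBundle 𝓘(ℝ, E).tangent (TangentBundle 𝓘(ℝ, E) M)) :=
  {ξ | ∃ (ε : ℝ) (γ : ℝ → TangentBundle 𝓘(ℝ, E) M), 0 < ε ∧
    ContMDiffOn 𝓘(ℝ, ℝ) 𝓘(ℝ, E).tangent ∞ γ (Ioo (-ε) ε) ∧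
    (∀ t ∈ Ioo (-ε) ε, nabla.derivAlong γ t = 0) ∧
    velocity 𝓘(ℝ, E).tangent γ 0 = ξ}

/-- The fibre at `u` of the horizontal distribution. The horizontal lift at `u` of a tangent vector
`v` is the element of this fibre with `dproj u ξ = v`. -/
def horizontalAt (u : TangentBundle 𝓘(ℝ, E) M) : Set (TangentSpace 𝓘(ℝ, E).tangent u) :=
  {ξ | (⟨u, ξ⟩ : TangentBundle 𝓘(ℝ, E).tangent (TangentBundle 𝓘(ℝ, E) M)) ∈ nabla.horizontal}

/-- `Ω` is the lift of `(∇, θ₀, θ₁, A)` to `TM`, where `θ₀`, `θ₁` are `2`-forms on `M` and `A` is a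
`(2,0)`-tensor field: `Ω(X^v, Y^v) = θ₀(X, Y)`, `Ω(X^h, Y^h) = θ₁(X, Y)`, `Ω(X^v, Y^h) = A(X, Y)`,
`Ω(X^h, Y^v) = -A(Y, X)`. -/
structure IsLift (θ₀ θ₁ : DiffForm 𝓘(ℝ, E) M 2) (A : Tensor20 E M)
    (Ω : DiffForm 𝓘(ℝ, E).tangent (TangentBundle 𝓘(ℝ, E) M) 2) : Prop where
  vert_vert : ∀ (u : TangentBundle 𝓘(ℝ, E) M) (v w : TangentSpace 𝓘(ℝ, E) u.proj),
    Ω u ![vertLift u v, vertLift u w] = θ₀ u.proj ![v, w]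
  hor_hor : ∀ (u : TangentBundle 𝓘(ℝ, E) M), ∀ ξ ∈ nabla.horizontalAt u,
    ∀ η ∈ nabla.horizontalAt u, Ω u ![ξ, η] = θ₁ u.proj ![dproj u ξ, dproj u η]
  vert_hor : ∀ (u : TangentBundle 𝓘(ℝ, E) M) (v : TangentSpace 𝓘(ℝ, E) u.proj),
    ∀ η ∈ nabla.horizontalAt u, Ω u ![vertLift u v, η] = A u.proj v (dproj u η)
  hor_vert : ∀ (u : TangentBundle 𝓘(ℝ, E) M), ∀ ξ ∈ nabla.horizontalAt u,
    ∀ w : TangentSpace 𝓘(ℝ, E) u.proj, Ω u ![ξ, vertLift u w] = -A u.proj w (dproj u ξ)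

/-- The vector field `τ(X, Y) = [X, Y] - ∇_X Y + ∇_Y X`. -/
def tau (X Y : (x : M) → TangentSpace 𝓘(ℝ, E) x) (x : M) : TangentSpace 𝓘(ℝ, E) x :=
  VectorField.mlieBracket 𝓘(ℝ, E) X Y x - nabla Y x (X x) + nabla X x (Y x)

/-- The function `(∇_X A)(Y, Z) = X(A(Y, Z)) - A(∇_X Y, Z) - A(Y, ∇_X Z)`. -/
def derivTensor (A : Tensor20 E M) (X Y Z : (x : M) → TangentSpace 𝓘(ℝ, E) x) (x : M) : ℝ :=
  mvfderiv 𝓘(ℝ, E) (fun y => A y (Y y) (Z y)) x (X x)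
    - A x (nabla Y x (X x)) (Z x) - A x (Y x) (nabla Z x (X x))

/-- The Codazzi equation `∇_X A(Z, Y) - ∇_Y A(Z, X) = A(Z, τ(X, Y))`. -/
def Codazzi (A : Tensor20 E M) : Prop :=
  ∀ X Y Z : (x : M) → TangentSpace 𝓘(ℝ, E) x,
    SmoothVectorField X → SmoothVectorField Y → SmoothVectorField Z → ∀ x : M,
      nabla.derivTensor A X Z Y x - nabla.derivTensor A Y Z X x = A x (Z x) (nabla.tau X Y x)

end LinearConnection

end Lift

end

/-!
Over a point `u` of `TM` the projection `dproj u` and the connector `K u` (the covariant derivative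
of a curve of tangent vectors is `K` applied to its velocity) give together an isomorphism
`T_u(TM) ≃ T_xM × T_xM`. The horizontal space at `u` is the kernel of `K u`, and `K u` inverts the
vertical lift. That every element of the kernel is the velocity of a parallel field along a smooth
curve is the only place where a differential equation has to be solved
(`LinearConnection.mem_horizontalAt_iff`). Hence the lift exists, is unique, and is
`Ω(ξ, η) = A(K ξ, dπ η) - A(K η, dπ ξ)` (`LinearConnection.liftForm`), which is smooth and
nondegenerate for every smooth nondegenerate `A`.

In a chart of `M`, with `Γ` the Christoffel symbols, let
`C(y; a, c) = ∂_a A(y, c) - A(Γ(y, a), c) - (∂_c A(y, a) - A(Γ(y, c), a))`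
(`LinearConnection.codazziCoord`). Three computations carry the proof.

* The difference of the two sides of the Codazzi equation is `C(Z; X, Y)`, so that the equation
  holds if and only if `C` vanishes, in all charts or only in the chart at each point
  (`LinearConnection.codazzi_eq_codazziCoord`).
* The pullback of `dλ` under `A♭` exceeds `Ω` by `C(u; dπ ξ, dπ η)`
  (`Tensor20.IsSmooth.d_liouville_mfderiv_flat`). This gives the equivalence with
  `Ω = (A♭)^*(dλ)`. Since `Ω` vanishes on pairs of horizontal vectors, the image of the horizontal
  distribution is isotropic if and only if `C = 0`; in that case it is Lagrangian, because `Ω` is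
  nondegenerate and `A♭` is a bijection with invertible differentials.
* If `C = 0`, the expression of `Ω` in a chart is the exterior derivative of `A(y, dx)`, so `Ω` is
  closed. Conversely, `dΩ` takes the value `-C(w; a, c)` on the vertical vector `w` and the
  coordinate vectors `a`, `c` of the base (`extDeriv_skewForm_liftModel`).
-/

noncomputable section

set_option synthInstance.maxHeartbeats 200000

/-! ### Charts of the tangent bundle -/

section

variable {E : Type*} [NormedAddCommGroup E] [NormedSpace ℝ E]
  {M : Type*} [TopologicalSpace M] [ChartedSpace E M] [IsManifold 𝓘(ℝ, E) ∞ M]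

/-- The components of a tangent vector at `x` in the chart at `x₀`; a linear isomorphism with
inverse `ofCoord x₀ x` if `x` lies in the domain of this chart, and zero otherwise. -/
def toCoord (x₀ x : M) : TangentSpace 𝓘(ℝ, E) x →L[ℝ] E :=
  (trivializationAt E (TangentSpace 𝓘(ℝ, E)) x₀).continuousLinearMapAt ℝ x

/-- The tangent vector at `x` with given components in the chart at `x₀`. -/
def ofCoord (x₀ x : M) : E →L[ℝ] TangentSpace 𝓘(ℝ, E) x :=
  (trivializationAt E (TangentSpace 𝓘(ℝ, E)) x₀).symmL ℝ x

variable {x₀ x : M}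

@[simp] theorem toCoord_ofCoord (hx : x ∈ (chartAt E x₀).source) (v : E) :
    toCoord x₀ x (ofCoord x₀ x v) = v :=
  (trivializationAt E (TangentSpace 𝓘(ℝ, E)) x₀).continuousLinearMapAt_symmL hx v

@[simp] theorem ofCoord_toCoord (hx : x ∈ (chartAt E x₀).source) (v : TangentSpace 𝓘(ℝ, E) x) :
    ofCoord x₀ x (toCoord x₀ x v) = v :=
  (trivializationAt E (TangentSpace 𝓘(ℝ, E)) x₀).symmL_continuousLinearMapAt hx v

theorem toCoord_self (x : M) (v : TangentSpace 𝓘(ℝ, E) x) : toCoord x x v = v := by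
  unfold toCoord
  rw [TangentBundle.continuousLinearMapAt_trivializationAt (by simp), mfderiv_extChartAt_self]
  rfl

theorem trivializationAt_snd {w : TangentBundle 𝓘(ℝ, E) M} (hx : w.proj ∈ (chartAt E x₀).source) :
    (trivializationAt E (TangentSpace 𝓘(ℝ, E)) x₀ w).2 = toCoord x₀ w.proj w.2 := by
  unfold toCoord
  rw [Trivialization.continuousLinearMapAt_apply, Trivialization.coe_linearMapAt_of_mem _ hx]

theorem mfderiv_extChartAt_eq_toCoord (hx : x ∈ (chartAt E x₀).source) :
    mfderiv 𝓘(ℝ, E) 𝓘(ℝ, E) (extChartAt 𝓘(ℝ, E) x₀) x = toCoord x₀ x :=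
  (TangentBundle.continuousLinearMapAt_trivializationAt hx).symm

theorem tangentChart_apply (p w : TangentBundle 𝓘(ℝ, E) M) :
    extChartAt 𝓘(ℝ, E).tangent p w =
      (extChartAt 𝓘(ℝ, E) p.proj w.proj,
        (trivializationAt E (TangentSpace 𝓘(ℝ, E)) p.proj w).2) := by
  rw [FiberBundle.extChartAt]; rfl

theorem mem_tangentChart_target {p : TangentBundle 𝓘(ℝ, E) M} {z : E × E} :
    z ∈ (extChartAt 𝓘(ℝ, E).tangent p).target ↔ z.1 ∈ (extChartAt 𝓘(ℝ, E) p.proj).target := by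
  rw [FiberBundle.extChartAt_target]
  simp
  intro h
  exact (chartAt E p.proj).map_target h

end

/-! ### Tangent vectors to the tangent bundle in coordinates, and Christoffel symbols -/

section

variable {E : Type*} [NormedAddCommGroup E] [NormedSpace ℝ E]
  {M : Type*} [TopologicalSpace M] [ChartedSpace E M] [IsManifold 𝓘(ℝ, E) ∞ M]
variable {x₀ x : M}

/-- The components of a tangent vector to `TM` at `u` in the chart of `TM` at `p`, first those along
the base and then those along the fibre. -/
def dcoord (p u : TangentBundle 𝓘(ℝ, E) M) : TangentSpace 𝓘(ℝ, E).tangent u →L[ℝ] E × E :=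
  mfderiv 𝓘(ℝ, E).tangent 𝓘(ℝ, E × E) (extChartAt 𝓘(ℝ, E).tangent p) u

theorem mdifferentiableAt_tangentChart {p u : TangentBundle 𝓘(ℝ, E) M}
    (h : u.proj ∈ (chartAt E p.proj).source) :
    MDifferentiableAt 𝓘(ℝ, E).tangent 𝓘(ℝ, E × E) (extChartAt 𝓘(ℝ, E).tangent p) u :=
  mdifferentiableAt_extChartAt (by simpa using h)

theorem mdifferentiableAt_proj (u : TangentBundle 𝓘(ℝ, E) M) :
    MDifferentiableAt 𝓘(ℝ, E).tangent 𝓘(ℝ, E) (fun w : TangentBundle 𝓘(ℝ, E) M => w.proj) u :=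
  (contMDiffAt_proj (n := 1) (TangentSpace 𝓘(ℝ, E) : M → Type _)).mdifferentiableAt one_ne_zero

theorem dcoord_fst {p u : TangentBundle 𝓘(ℝ, E) M} (h : u.proj ∈ (chartAt E p.proj).source)
    (ξ : TangentSpace 𝓘(ℝ, E).tangent u) :
    (dcoord p u ξ).1 = toCoord p.proj u.proj (dproj u ξ) := by
  have h1 : HasMFDerivAt 𝓘(ℝ, E).tangent 𝓘(ℝ, E)
      (Prod.fst ∘ (extChartAt 𝓘(ℝ, E).tangent p)) u
      ((ContinuousLinearMap.fst ℝ E E).comp (dcoord p u)) :=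
    (ContinuousLinearMap.fst ℝ E E).hasMFDerivAt.comp u
      (mdifferentiableAt_tangentChart h).hasMFDerivAt
  have h2 : HasMFDerivAt 𝓘(ℝ, E).tangent 𝓘(ℝ, E)
      (extChartAt 𝓘(ℝ, E) p.proj ∘ (fun w : TangentBundle 𝓘(ℝ, E) M => w.proj)) u
      ((toCoord p.proj u.proj).comp (dproj u) : TangentSpace 𝓘(ℝ, E).tangent u →L[ℝ] E) := by
    have h4 := mfderiv_extChartAt_eq_toCoord h
    exact h4 ▸ (mdifferentiableAt_extChartAt h).hasMFDerivAt.comp u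
      (mdifferentiableAt_proj u).hasMFDerivAt
  have h3 : Prod.fst ∘ (extChartAt 𝓘(ℝ, E).tangent p) =
    (extChartAt 𝓘(ℝ, E) p.proj ∘ (fun w : TangentBundle 𝓘(ℝ, E) M => w.proj)) := by
    funext w; simp
  rw [h3] at h1
  exact congr($(hasMFDerivAt_unique h1 h2) ξ)

theorem dcoord_snd {p u : TangentBundle 𝓘(ℝ, E) M} (h : u.proj ∈ (chartAt E p.proj).source) :
    HasMFDerivAt 𝓘(ℝ, E).tangent 𝓘(ℝ, E)
      (fun w : TangentBundle 𝓘(ℝ, E) M => (trivializationAt E (TangentSpace 𝓘(ℝ, E)) p.proj w).2) u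
      ((ContinuousLinearMap.snd ℝ E E).comp (dcoord p u)) := by
  have h1 : HasMFDerivAt 𝓘(ℝ, E).tangent 𝓘(ℝ, E)
      (Prod.snd ∘ (extChartAt 𝓘(ℝ, E).tangent p)) u
      ((ContinuousLinearMap.snd ℝ E E).comp (dcoord p u)) :=
    (ContinuousLinearMap.snd ℝ E E).hasMFDerivAt.comp u
      (mdifferentiableAt_tangentChart h).hasMFDerivAt
  exact h1

theorem dcoord_bijective {p u : TangentBundle 𝓘(ℝ, E) M} (h : u.proj ∈ (chartAt E p.proj).source) :
    Function.Bijective (dcoord p u) :=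
  (isInvertible_mfderiv_extChartAt (I := 𝓘(ℝ, E).tangent) (x := p) (y := u)
    (by simpa using h)).bijective

theorem dcoord_symm {p : TangentBundle 𝓘(ℝ, E) M} {z : E × E}
    (hz : z ∈ (extChartAt 𝓘(ℝ, E).tangent p).target) (ζ : E × E) :
    dcoord p ((extChartAt 𝓘(ℝ, E).tangent p).symm z)
      (mfderivWithin 𝓘(ℝ, E × E) 𝓘(ℝ, E).tangent (extChartAt 𝓘(ℝ, E).tangent p).symm
        (range 𝓘(ℝ, E).tangent) z ζ) = ζ :=
  congr($(mfderiv_extChartAt_comp_mfderivWithin_extChartAt_symm hz) ζ)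

theorem dcoord_vertLift {p u : TangentBundle 𝓘(ℝ, E) M} (h : u.proj ∈ (chartAt E p.proj).source)
    (v : TangentSpace 𝓘(ℝ, E) u.proj) :
    dcoord p u (vertLift u v) = (0, toCoord p.proj u.proj v) := by
  have h1 : (extChartAt 𝓘(ℝ, E).tangent p) ∘
      (fun w : E => (⟨u.proj, w⟩ : TangentBundle 𝓘(ℝ, E) M)) =
      fun w : E => (extChartAt 𝓘(ℝ, E) p.proj u.proj, toCoord p.proj u.proj w) := by
    funext w
    exact (tangentChart_apply p _).trans
      (Prod.ext rfl (trivializationAt_snd (w := (⟨u.proj, w⟩ : TangentBundle 𝓘(ℝ, E) M)) h))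
  have hm : MDifferentiableAt 𝓘(ℝ, E) 𝓘(ℝ, E).tangent
      (fun w : E => (⟨u.proj, w⟩ : TangentBundle 𝓘(ℝ, E) M)) u.2 := by
    refine (mdifferentiableAt_totalSpace _ _).2 ⟨mdifferentiableAt_const, ?_⟩
    have : (fun w : E => (trivializationAt E (TangentSpace 𝓘(ℝ, E)) u.proj ⟨u.proj, w⟩).2) =
       fun w : E => w := by
      funext w
      exact (trivializationAt_snd (w := (⟨u.proj, w⟩ : TangentBundle 𝓘(ℝ, E) M)) (by simp)).trans
        (toCoord_self _ _)
    rw [this]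
    exact mdifferentiableAt_id
  have h2 := (mdifferentiableAt_tangentChart (p := p) (u := u) h).hasMFDerivAt.comp
    (f := (fun w : E => (⟨u.proj, w⟩ : TangentBundle 𝓘(ℝ, E) M))) u.2 hm.hasMFDerivAt
  rw [h1] at h2
  have h3 : HasFDerivAt (fun w : E => (extChartAt 𝓘(ℝ, E) p.proj u.proj, toCoord p.proj u.proj w))
      ((0 : E →L[ℝ] E).prod (toCoord p.proj u.proj)) u.2 :=
    (hasFDerivAt_const _ _).prodMk (toCoord p.proj u.proj).hasFDerivAt
  exact congr($(hasMFDerivAt_unique h2 h3.hasMFDerivAt) v)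

theorem dproj_vertLift (u : TangentBundle 𝓘(ℝ, E) M) (v : TangentSpace 𝓘(ℝ, E) u.proj) :
    dproj u (vertLift u v) = 0 := by
  have h := dcoord_fst (p := u) (u := u) (by simp) (vertLift u v)
  rw [dcoord_vertLift (by simp)] at h
  exact (h.trans (toCoord_self _ _)).symm

/-- The components of a vector field in the chart at `x₀`, as a function on `M`. -/
def coordRep (x₀ : M) (σ : (x : M) → TangentSpace 𝓘(ℝ, E) x) (x : M) : E := toCoord x₀ x (σ x)

theorem mdifferentiableAt_section_iff_coordRep (hx : x ∈ (chartAt E x₀).source)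
   (σ : (x : M) → TangentSpace 𝓘(ℝ, E) x) :
   MDifferentiableAt 𝓘(ℝ, E) 𝓘(ℝ, E).tangent (fun x => (⟨x, σ x⟩ : TangentBundle 𝓘(ℝ, E) M)) x ↔
    MDifferentiableAt 𝓘(ℝ, E) 𝓘(ℝ, E) (coordRep x₀ σ) x := by
  refine ((trivializationAt E (TangentSpace 𝓘(ℝ, E)) x₀).mdifferentiableAt_section_iff
    𝓘(ℝ, E) σ hx).trans (Filter.EventuallyEq.mdifferentiableAt_iff ?_)
  filter_upwards [(chartAt E x₀).open_source.mem_nhds hx] with y hy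
  exact trivializationAt_snd (w := (⟨y, σ y⟩ : TangentBundle 𝓘(ℝ, E) M)) hy

theorem contMDiffAt_section_iff_coordRep (hx : x ∈ (chartAt E x₀).source)
   (σ : (x : M) → TangentSpace 𝓘(ℝ, E) x) :
   ContMDiffAt 𝓘(ℝ, E) 𝓘(ℝ, E).tangent ∞ (fun x => (⟨x, σ x⟩ : TangentBundle 𝓘(ℝ, E) M)) x ↔
    ContMDiffAt 𝓘(ℝ, E) 𝓘(ℝ, E) ∞ (coordRep x₀ σ) x := by
  refine ((trivializationAt E (TangentSpace 𝓘(ℝ, E)) x₀).contMDiffAt_section_iff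
    (IB := 𝓘(ℝ, E)) hx).trans (Filter.EventuallyEq.contMDiffAt_iff ?_)
  filter_upwards [(chartAt E x₀).open_source.mem_nhds hx] with y hy
  exact trivializationAt_snd (w := (⟨y, σ y⟩ : TangentBundle 𝓘(ℝ, E) M)) hy

/-- The flat covariant derivative of the chart at `x₀`: the derivative of the components. -/
def flatDeriv (x₀ : M) (σ : (x : M) → TangentSpace 𝓘(ℝ, E) x) (x : M) :
    TangentSpace 𝓘(ℝ, E) x →L[ℝ] TangentSpace 𝓘(ℝ, E) x :=
  (ofCoord x₀ x).comp (mvfderiv 𝓘(ℝ, E) (coordRep x₀ σ) x)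

theorem isCovariantDerivativeOn_flatDeriv (x₀ : M) :
    IsCovariantDerivativeOn (I := 𝓘(ℝ, E)) E (flatDeriv x₀) (chartAt E x₀).source where
  add {σ σ' x} hσ hσ' hx := by
    rw [mdifferentiableAt_section_iff_coordRep hx] at hσ hσ'
    have : coordRep x₀ (σ + σ') = coordRep x₀ σ + coordRep x₀ σ' := by
      funext z; exact map_add _ _ _
    rw [flatDeriv, this, mvfderiv_add hσ hσ', ContinuousLinearMap.comp_add]
    rfl
  leibniz {σ g x} hσ hg hx := by
    rw [mdifferentiableAt_section_iff_coordRep hx] at hσ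
    have : coordRep x₀ (g • σ) = g • coordRep x₀ σ := by
      funext z; exact map_smul (toCoord x₀ z) (g z) (σ z)
    ext v
    rw [flatDeriv, this, mvfderiv_smul hg hσ]
    simp [flatDeriv, coordRep, hx]

variable [FiniteDimensional ℝ E]
section BilinPullback

variable {V W F : Type*} [AddCommGroup V] [Module ℝ V] [TopologicalSpace V]
  [AddCommGroup W] [Module ℝ W] [TopologicalSpace W] [IsTopologicalAddGroup W]
  [ContinuousSMul ℝ W] [NormedAddCommGroup F] [NormedSpace ℝ F]

/-- The bilinear map `(a, b) ↦ q (B (p a) (p b))` on a finite-dimensional space. -/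
def bilinPullback (B : V →L[ℝ] V →L[ℝ] W) (p : E →L[ℝ] V) (q : W →L[ℝ] F) :
    E →L[ℝ] E →L[ℝ] F :=
  LinearMap.toContinuousLinearMap
    { toFun := fun a => q.comp ((B (p a)).comp p)
      map_add' := fun a b => by ext; simp
      map_smul' := fun a b => by ext; simp }

@[simp] theorem bilinPullback_apply (B : V →L[ℝ] V →L[ℝ] W) (p : E →L[ℝ] V) (q : W →L[ℝ] F)
    (a b : E) : bilinPullback B p q a b = q (B (p a) (p b)) := rfl

end BilinPullback

namespace LinearConnection
variable (nabla : LinearConnection E M)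

/-- The Christoffel symbols of a connection in the chart at `x₀`, at the point with coordinates `z`:
`christoffel x₀ z y a` are the components of `∇_a σ` for the field `σ` with constant components `y`.
They are the difference of the connection and the flat one. -/
def christoffel (x₀ : M) (z : E) : E →L[ℝ] E →L[ℝ] E :=
  bilinPullback (IsCovariantDerivativeOn.difference nabla.isCovariantDerivativeOn
    (isCovariantDerivativeOn_flatDeriv x₀) ((extChartAt 𝓘(ℝ, E) x₀).symm z))
    (ofCoord x₀ _) (toCoord x₀ _)

/-- The formula `(∇_v σ)^k = v(σ^k) + Γ_{ij}^k v^i σ^j`. -/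
theorem toCoord_apply (hx : x ∈ (chartAt E x₀).source) {σ : (x : M) → TangentSpace 𝓘(ℝ, E) x}
    (hσ : MDifferentiableAt 𝓘(ℝ, E) 𝓘(ℝ, E).tangent
      (fun x => (⟨x, σ x⟩ : TangentBundle 𝓘(ℝ, E) M)) x)
    (v : TangentSpace 𝓘(ℝ, E) x) :
    toCoord x₀ x (nabla σ x v) = mvfderiv 𝓘(ℝ, E) (coordRep x₀ σ) x v +
      nabla.christoffel x₀ (extChartAt 𝓘(ℝ, E) x₀ x) (toCoord x₀ x (σ x)) (toCoord x₀ x v) := by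
  have h := IsCovariantDerivativeOn.difference_apply nabla.isCovariantDerivativeOn
    (isCovariantDerivativeOn_flatDeriv x₀) hx hσ
  have hx' : (extChartAt 𝓘(ℝ, E) x₀).symm (extChartAt 𝓘(ℝ, E) x₀ x) = x :=
    (extChartAt 𝓘(ℝ, E) x₀).left_inv (by simpa using hx)
  rw [christoffel, bilinPullback_apply, hx', ofCoord_toCoord hx, ofCoord_toCoord hx, h]
  simp [flatDeriv, hx]
end LinearConnection

end

/-! ### The connector of a linear connection -/

section

variable {E : Type*} [NormedAddCommGroup E] [NormedSpace ℝ E]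
  {M : Type*} [TopologicalSpace M] [ChartedSpace E M] [IsManifold 𝓘(ℝ, E) ∞ M]
variable {x₀ x : M}

/-- The change of components at `z` from the chart at `x₁` to the chart at `x₀`. -/
def transition (x₁ x₀ z : M) : E →L[ℝ] E :=
  ((trivializationAt E (TangentSpace 𝓘(ℝ, E)) x₁).coordChangeL ℝ
    (trivializationAt E (TangentSpace 𝓘(ℝ, E)) x₀) z : E →L[ℝ] E)

theorem transition_apply {x₁ x₀ z : M} (h₁ : z ∈ (chartAt E x₁).source)
    (h₀ : z ∈ (chartAt E x₀).source) (v : E) :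
    transition x₁ x₀ z v = toCoord x₀ z (ofCoord x₁ z v) := by
  unfold transition toCoord ofCoord
  rw [ContinuousLinearEquiv.coe_coe, Trivialization.coordChangeL_apply _ _ ⟨h₁, h₀⟩,
    Trivialization.continuousLinearMapAt_apply, Trivialization.coe_linearMapAt_of_mem _ h₀,
    Trivialization.symmL_apply _ h₁]

theorem mdifferentiableAt_transition {x₁ x₀ z : M} (h₁ : z ∈ (chartAt E x₁).source)
    (h₀ : z ∈ (chartAt E x₀).source) :
    MDifferentiableAt 𝓘(ℝ, E) 𝓘(ℝ, E →L[ℝ] E) (transition (E := E) x₁ x₀) z :=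
  (contMDiffAt_coordChangeL (n := 1) h₁ h₀).mdifferentiableAt one_ne_zero

theorem HasMFDerivAt.clm_apply {V H N F₁ F₂ : Type*} [NormedAddCommGroup V] [NormedSpace ℝ V]
    [TopologicalSpace H] {I : ModelWithCorners ℝ V H} [TopologicalSpace N] [ChartedSpace H N]
    [NormedAddCommGroup F₁] [NormedSpace ℝ F₁] [NormedAddCommGroup F₂] [NormedSpace ℝ F₂]
    {g : N → F₁ →L[ℝ] F₂} {f : N → F₁} {x : N} {g' : TangentSpace I x →L[ℝ] (F₁ →L[ℝ] F₂)}
    {f' : TangentSpace I x →L[ℝ] F₁}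
    (hg : HasMFDerivAt I 𝓘(ℝ, F₁ →L[ℝ] F₂) g x g') (hf : HasMFDerivAt I 𝓘(ℝ, F₁) f x f') :
    HasMFDerivAt I 𝓘(ℝ, F₂) (fun y => g y (f y)) x
      ((ContinuousLinearMap.apply ℝ F₂ (f x)).comp g' + (g x).comp f') := by
  have hpair : HasMFDerivAt I 𝓘(ℝ, (F₁ →L[ℝ] F₂) × F₁) (fun y => (g y, f y)) x (g'.prod f') :=
    ⟨hg.1.prodMk hf.1, hg.2.prodMk hf.2⟩
  have h := HasMFDerivAt.comp x ((isBoundedBilinearMap_apply (𝕜 := ℝ) (E := F₁)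
    (F := F₂)).hasFDerivAt (g x, f x)).hasMFDerivAt hpair
  refine h.congr_mfderiv ?_
  ext v
  exact add_comm _ _

/-- The fibre components of a tangent vector to `TM` in two charts differ by the derivative of the
components of a field that is constant in one of the charts. -/
theorem dcoord_snd_change {p u : TangentBundle 𝓘(ℝ, E) M} (h : u.proj ∈ (chartAt E p.proj).source)
    (ξ : TangentSpace 𝓘(ℝ, E).tangent u) :
    (dcoord p u ξ).2 = toCoord p.proj u.proj (ofCoord u.proj u.proj (dcoord u u ξ).2) +
      mvfderiv 𝓘(ℝ, E) (coordRep p.proj (FiberBundle.extend E u.2)) u.proj (dproj u ξ) := by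
  have hu : u.proj ∈ (chartAt E u.proj).source := by simp
  -- Differentiate `(components of w in the chart at p) = C · (components of w in the chart at u)`.
  set C := transition (E := E) u.proj p.proj with hC
  have hCd := (mdifferentiableAt_transition hu h).hasMFDerivAt
  have hCp : HasMFDerivAt 𝓘(ℝ, E).tangent 𝓘(ℝ, E →L[ℝ] E)
      (fun w : TangentBundle 𝓘(ℝ, E) M => C w.proj) u
      ((mvfderiv 𝓘(ℝ, E) C u.proj).comp (dproj u)) :=
    hCd.comp u (mdifferentiableAt_proj u).hasMFDerivAt
  have h1 := hCp.clm_apply (dcoord_snd (p := u) (u := u) hu)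
  have hmem : ∀ᶠ z in 𝓝 u.proj, z ∈ (chartAt E p.proj).source ∧ z ∈ (chartAt E u.proj).source :=
    Filter.eventually_and.2 ⟨(chartAt E p.proj).open_source.mem_nhds h,
      (chartAt E u.proj).open_source.mem_nhds hu⟩
  have h2 := (dcoord_snd (p := p) (u := u) h).congr_of_eventuallyEq
    (f₁ := fun w : TangentBundle 𝓘(ℝ, E) M => C w.proj
        (trivializationAt E (TangentSpace 𝓘(ℝ, E)) u.proj w).2) (by
      have := (FiberBundle.continuous_proj E (TangentSpace 𝓘(ℝ, E) : M → Type _)).continuousAt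
        (x := u) hmem
      filter_upwards [this] with w hw
      rw [hC, transition_apply hw.2 hw.1, trivializationAt_snd hw.1, trivializationAt_snd hw.2,
        ofCoord_toCoord hw.2])
  have h3 := congr($(hasMFDerivAt_unique h2 h1) ξ)
  have h4 : HasMFDerivAt 𝓘(ℝ, E) 𝓘(ℝ, E)
      (fun z => C z (trivializationAt E (TangentSpace 𝓘(ℝ, E)) u.proj u).2) u.proj _ :=
    HasMFDerivAt.clm_apply (g' := mvfderiv 𝓘(ℝ, E) C u.proj) (f' := 0) hCd
      (hasMFDerivAt_const _ _)
  have h5 := h4.congr_of_eventuallyEq (f₁ := coordRep p.proj (FiberBundle.extend E u.2)) (by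
      filter_upwards [hmem] with z hz
      rw [hC, transition_apply hz.2 hz.1, ofCoord, Trivialization.symmL_apply _ hz.2]
      rfl)
  have h6 : mvfderiv 𝓘(ℝ, E) (coordRep p.proj (FiberBundle.extend E u.2)) u.proj (dproj u ξ) =
      mvfderiv 𝓘(ℝ, E) C u.proj (dproj u ξ)
        (trivializationAt E (TangentSpace 𝓘(ℝ, E)) u.proj u).2 := by
    have := congr($(h5.mfderiv) (dproj u ξ))
    refine this.trans ?_
    rw [ContinuousLinearMap.comp_zero, add_zero]
    rfl
  rw [h6, ← transition_apply hu h, ← hC]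
  exact h3.trans (add_comm _ _)

namespace LinearConnection
variable (nabla : LinearConnection E M)

/-- The connector `K u : T_u(TM) → T_xM` of a connection, defined by means of the chart at `u`. -/
def connector (u : TangentBundle 𝓘(ℝ, E) M) :
    TangentSpace 𝓘(ℝ, E).tangent u →L[ℝ] TangentSpace 𝓘(ℝ, E) u.proj :=
  (ofCoord u.proj u.proj).comp ((ContinuousLinearMap.snd ℝ E E).comp (dcoord u u)) +
    (nabla (FiberBundle.extend E u.2) u.proj).comp (dproj u)

variable [FiniteDimensional ℝ E] in
/-- The formula `K(a, b)^k = b^k + Γ_{ij}^k a^i u^j` for the connector, valid in every chart. -/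
theorem toCoord_connector {p u : TangentBundle 𝓘(ℝ, E) M} (h : u.proj ∈ (chartAt E p.proj).source)
    (ξ : TangentSpace 𝓘(ℝ, E).tangent u) :
    toCoord p.proj u.proj (nabla.connector u ξ) = (dcoord p u ξ).2 +
      nabla.christoffel p.proj (extChartAt 𝓘(ℝ, E) p.proj u.proj) (toCoord p.proj u.proj u.2)
        (dcoord p u ξ).1 := by
  rw [dcoord_snd_change h, dcoord_fst h, connector, add_apply, map_add,
    ContinuousLinearMap.comp_apply, ContinuousLinearMap.comp_apply,
    ContinuousLinearMap.comp_apply, 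
    nabla.toCoord_apply h (FiberBundle.mdifferentiableAt_extend _ _ _),
    FiberBundle.extend_apply_self, add_assoc]
  rfl

theorem connector_vertLift (u : TangentBundle 𝓘(ℝ, E) M) (v : TangentSpace 𝓘(ℝ, E) u.proj) :
    nabla.connector u (vertLift u v) = v := by
  have hu : u.proj ∈ (chartAt E u.proj).source := by simp
  rw [connector, add_apply, ContinuousLinearMap.comp_apply,
    ContinuousLinearMap.comp_apply, ContinuousLinearMap.comp_apply, dcoord_vertLift hu,
    dproj_vertLift, map_zero, add_zero]
  exact ofCoord_toCoord hu v

variable [FiniteDimensional ℝ E] in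
/-- A tangent vector to `TM` amounts to its projection and its image under the connector. -/
theorem dproj_connector_bijective (u : TangentBundle 𝓘(ℝ, E) M) :
    Function.Bijective fun ξ : TangentSpace 𝓘(ℝ, E).tangent u =>
      (dproj u ξ, nabla.connector u ξ) := by
  have hu : u.proj ∈ (chartAt E u.proj).source := by simp
  constructor
  · intro ξ η h
    have h1 : dproj u ξ = dproj u η := congr($h.1)
    have h2 : nabla.connector u ξ = nabla.connector u η := congr($h.2)
    apply (dcoord_bijective (p := u) hu).1
    have h3 : (dcoord u u ξ).1 = (dcoord u u η).1 := by rw [dcoord_fst hu, dcoord_fst hu, h1]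
    have h4 := congr(toCoord u.proj u.proj $h2)
    rw [nabla.toCoord_connector hu, nabla.toCoord_connector hu, h3] at h4
    exact Prod.ext h3 (add_right_cancel h4)
  · rintro ⟨v, w⟩
    obtain ⟨ξ, hξ⟩ := (dcoord_bijective (p := u) hu).2
      (toCoord u.proj u.proj v, toCoord u.proj u.proj w -
        nabla.christoffel u.proj (extChartAt 𝓘(ℝ, E) u.proj u.proj) (toCoord u.proj u.proj u.2)
        (toCoord u.proj u.proj v))
    have h1 := dcoord_fst hu ξ
    have h2 := nabla.toCoord_connector hu ξ
    rw [hξ] at h1 h2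
    refine ⟨ξ, Prod.ext ?_ ?_⟩
    · have := congr(ofCoord u.proj u.proj $h1)
      rw [ofCoord_toCoord hu, ofCoord_toCoord hu] at this
      exact this.symm
    · rw [sub_add_cancel] at h2
      have := congr(ofCoord u.proj u.proj $h2)
      rw [ofCoord_toCoord hu, ofCoord_toCoord hu] at this
      exact this

theorem derivAlong_eq_connector {γ : ℝ → TangentBundle 𝓘(ℝ, E) M} {t : ℝ}
    (hγ : MDifferentiableAt 𝓘(ℝ, ℝ) 𝓘(ℝ, E).tangent γ t) :
    nabla.derivAlong γ t = nabla.connector (γ t) (velocity 𝓘(ℝ, E).tangent γ t).2 := by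
  have hu : (γ t).proj ∈ (chartAt E (γ t).proj).source := by simp
  have h1 := (dcoord_snd (p := γ t) hu).comp t hγ.hasMFDerivAt
  have h2 := (mdifferentiableAt_proj (γ t)).hasMFDerivAt.comp t hγ.hasMFDerivAt
  have h3 : (velocity 𝓘(ℝ, E) (fun s => (γ s).proj) t).2 =
      dproj (γ t) (velocity 𝓘(ℝ, E).tangent γ t).2 := congr($(h2.mfderiv) (1 : ℝ))
  have h4 : HasFDerivAt (F := E)
      (fun s => (trivializationAt E (TangentSpace 𝓘(ℝ, E)) (γ t).proj (γ s)).2)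
      (((ContinuousLinearMap.snd ℝ E E).comp (dcoord (γ t) (γ t))).comp
        (mfderiv 𝓘(ℝ, ℝ) 𝓘(ℝ, E).tangent γ t) : ℝ →L[ℝ] E) t := h1.hasFDerivAt
  refine congr_arg₂ (fun a b : TangentSpace 𝓘(ℝ, E) (γ t).proj => a + b) ?_
    congr(nabla (FiberBundle.extend E (γ t).2) (γ t).proj $h3)
  refine h4.hasDerivAt.deriv.trans ?_
  have := toCoord_self _ (ofCoord (γ t).proj (γ t).proj
    ((dcoord (γ t) (γ t)) (velocity 𝓘(ℝ, E).tangent γ t).snd).2)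
  rw [toCoord_ofCoord hu] at this
  exact this
end LinearConnection

end

/-! ### Smoothness of tensor fields and connections in charts -/

section

variable {E : Type*} [NormedAddCommGroup E] [NormedSpace ℝ E]
  {M : Type*} [TopologicalSpace M] [ChartedSpace E M] [IsManifold 𝓘(ℝ, E) ∞ M]
variable {x₀ x : M}

theorem coordRep_ofCoord_eventuallyEq (hx : x ∈ (chartAt E x₀).source) (y : E) :
    coordRep x₀ (fun z => ofCoord x₀ z y) =ᶠ[𝓝 x] fun _ => y := by
  filter_upwards [(chartAt E x₀).open_source.mem_nhds hx] with z hz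
  exact toCoord_ofCoord hz y

theorem contMDiffAt_ofCoord (hx : x ∈ (chartAt E x₀).source) (y : E) :
    ContMDiffAt 𝓘(ℝ, E) 𝓘(ℝ, E).tangent ∞
      (fun z => (⟨z, ofCoord x₀ z y⟩ : TangentBundle 𝓘(ℝ, E) M)) x := by
  rw [contMDiffAt_section_iff_coordRep hx]
  exact contMDiffAt_const.congr_of_eventuallyEq (coordRep_ofCoord_eventuallyEq hx y)

/-- A vector field with constant components agrees near a given point with a global smooth vector
field. This is where `M` has to be Hausdorff. -/
theorem exists_smoothVectorField_eventuallyEq [FiniteDimensional ℝ E] [T2Space M]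
    (hx : x ∈ (chartAt E x₀).source) (y : E) :
    ∃ σ : (x : M) → TangentSpace 𝓘(ℝ, E) x, SmoothVectorField σ ∧
      ∀ᶠ z in 𝓝 x, σ z = ofCoord x₀ z y := by
  obtain ⟨f, -, hf⟩ := (SmoothBumpFunction.nhds_basis_tsupport (I := 𝓘(ℝ, E)) x).mem_iff.1
    ((chartAt E x₀).open_source.mem_nhds hx)
  refine ⟨(f : M → ℝ) • fun z => ofCoord x₀ z y, ?_, ?_⟩
  · exact ContMDiffOn.smul_section_of_tsupport f.contMDiff.contMDiffOn (chartAt E x₀).open_source hf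
      (fun z hz => (contMDiffAt_ofCoord hz y).contMDiffWithinAt)
  · filter_upwards [f.eventuallyEq_one] with z hz
    change f z • ofCoord x₀ z y = _
    rw [hz, Pi.one_apply, one_smul]

omit [IsManifold 𝓘(ℝ, E) ∞ M] in
theorem symm_mem_source {z : E} (hz : z ∈ (extChartAt 𝓘(ℝ, E) x₀).target) :
    (extChartAt 𝓘(ℝ, E) x₀).symm z ∈ (chartAt E x₀).source := by
  have := (extChartAt 𝓘(ℝ, E) x₀).map_target hz
  rwa [extChartAt_source] at this

theorem contDiffAt_comp_symm {F : Type*} [NormedAddCommGroup F] [NormedSpace ℝ F] {f : M → F}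
    {z : E} (hz : z ∈ (extChartAt 𝓘(ℝ, E) x₀).target)
    (hf : ContMDiffAt 𝓘(ℝ, E) 𝓘(ℝ, F) ∞ f ((extChartAt 𝓘(ℝ, E) x₀).symm z)) :
    ContDiffAt ℝ ∞ (fun w => f ((extChartAt 𝓘(ℝ, E) x₀).symm w)) z := by
  refine ContMDiffAt.contDiffAt (ContMDiffAt.comp z hf ?_)
  exact (contMDiffOn_extChartAt_symm x₀).contMDiffAt ((isOpen_extChartAt_target x₀).mem_nhds hz)

variable [FiniteDimensional ℝ E]

/-- The components of a `(2,0)`-tensor field in the chart at `x₀`, at the point with coordinates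
`z`. -/
def Tensor20.coord (A : Tensor20 E M) (x₀ : M) (z : E) : E →L[ℝ] E →L[ℝ] ℝ :=
  bilinPullback (A ((extChartAt 𝓘(ℝ, E) x₀).symm z)) (ofCoord x₀ _) (ContinuousLinearMap.id ℝ ℝ)

theorem Tensor20.coord_toCoord (A : Tensor20 E M) (hx : x ∈ (chartAt E x₀).source)
    (v w : TangentSpace 𝓘(ℝ, E) x) :
    A.coord x₀ (extChartAt 𝓘(ℝ, E) x₀ x) (toCoord x₀ x v) (toCoord x₀ x w) = A x v w := by
  have hx' : (extChartAt 𝓘(ℝ, E) x₀).symm (extChartAt 𝓘(ℝ, E) x₀ x) = x :=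
    (extChartAt 𝓘(ℝ, E) x₀).left_inv (by simpa using hx)
  rw [coord, bilinPullback_apply, hx', ofCoord_toCoord hx, ofCoord_toCoord hx]
  rfl

/-- On a finite-dimensional source, smoothness of a family of linear maps is pointwise. -/
theorem contDiffAt_clm_apply_iff {D F G : Type*} [NormedAddCommGroup D] [NormedSpace ℝ D]
    [NormedAddCommGroup F] [NormedSpace ℝ F] [FiniteDimensional ℝ F] [NormedAddCommGroup G]
    [NormedSpace ℝ G] {f : D → F →L[ℝ] G} {z : D} {n : ℕ∞ω} :
    ContDiffAt ℝ n f z ↔ ∀ y, ContDiffAt ℝ n (fun w => f w y) z := by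
  refine ⟨fun h y => h.clm_apply contDiffAt_const, fun h => ?_⟩
  have hd : Module.finrank ℝ F = Module.finrank ℝ (Fin (Module.finrank ℝ F) → ℝ) :=
    (Module.finrank_fin_fun ℝ).symm
  let e₁ := ContinuousLinearEquiv.ofFinrankEq hd
  let e₂ := (e₁.arrowCongr (1 : G ≃L[ℝ] G)).trans (ContinuousLinearEquiv.piRing _)
  rw [← Function.id_comp f, ← e₂.symm_comp_self]
  exact e₂.symm.contDiff.contDiffAt.comp z (contDiffAt_pi.mpr fun i => h _)

theorem Tensor20.IsSmooth.contDiffAt_coord {A : Tensor20 E M} (hA : A.IsSmooth) {z : E}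
    (hz : z ∈ (extChartAt 𝓘(ℝ, E) x₀).target) : ContDiffAt ℝ ∞ (A.coord x₀) z := by
  refine contDiffAt_clm_apply_iff.2 fun b => contDiffAt_clm_apply_iff.2 fun c => ?_
  refine contDiffAt_comp_symm (f := fun x => A x (ofCoord x₀ x b) (ofCoord x₀ x c)) hz ?_
  have hs := symm_mem_source hz
  have := ContMDiffAt.clm_bundle_apply₂ (E₃ := Bundle.Trivial M ℝ) (F₃ := ℝ) (hA _)
    (contMDiffAt_ofCoord hs b) (contMDiffAt_ofCoord hs c)
  exact (contMDiffAt_totalSpace.1 this).2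

theorem LinearConnection.contDiffAt_christoffel [T2Space M] (nabla : LinearConnection E M)
    [nabla.ContMDiffCovariantDerivative ∞] {z : E}
    (hz : z ∈ (extChartAt 𝓘(ℝ, E) x₀).target) : ContDiffAt ℝ ∞ (nabla.christoffel x₀) z := by
  refine contDiffAt_clm_apply_iff.2 fun y => contDiffAt_clm_apply_iff.2 fun a => ?_
  have hs := symm_mem_source hz
  obtain ⟨σ, hσ, hσe⟩ := exists_smoothVectorField_eventuallyEq hs y
  have h1 : ContMDiffAt 𝓘(ℝ, E) 𝓘(ℝ, E) ∞
      (coordRep x₀ fun x => nabla σ x (ofCoord x₀ x a)) ((extChartAt 𝓘(ℝ, E) x₀).symm z) := by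
    rw [← contMDiffAt_section_iff_coordRep hs]
    have := (CovariantDerivative.ContMDiffCovariantDerivative.contMDiff
      (cov := nabla) (k := ∞)).contMDiff (σ := σ) hσ.contMDiffOn
    exact (this.contMDiffAt Filter.univ_mem).clm_bundle_apply (contMDiffAt_ofCoord hs a)
  refine (contDiffAt_comp_symm hz h1).congr_of_eventuallyEq ?_
  have hc : ContinuousAt (extChartAt 𝓘(ℝ, E) x₀).symm z := continuousAt_extChartAt_symm'' hz
  filter_upwards [hc hσe.eventually_nhds, (isOpen_extChartAt_target x₀).mem_nhds hz] with w hw hwt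
  have hws := symm_mem_source hwt
  have hσd := (hσ.contMDiffAt (x := (extChartAt 𝓘(ℝ, E) x₀).symm w)).mdifferentiableAt (by simp)
  rw [coordRep, nabla.toCoord_apply hws hσd, toCoord_ofCoord hws,
    (extChartAt 𝓘(ℝ, E) x₀).right_inv hwt]
  have hw' : coordRep x₀ σ =ᶠ[𝓝 ((extChartAt 𝓘(ℝ, E) x₀).symm w)] fun _ => y := by
    filter_upwards [hw, coordRep_ofCoord_eventuallyEq hws y] with x hx hx'
    rw [← hx', coordRep, hx]; rfl
  have h0 : mvfderiv 𝓘(ℝ, E) (coordRep x₀ σ) ((extChartAt 𝓘(ℝ, E) x₀).symm w) = 0 := by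
    rw [mvfderiv, hw'.mfderiv_eq]
    exact mvfderiv_const (I := 𝓘(ℝ, E)) y
  rw [h0, show toCoord x₀ _ (σ _) = y from hw'.self_of_nhds]
  exact (zero_add _).symm

end

/-! ### The horizontal distribution is the kernel of the connector -/

section

variable {E : Type*} [NormedAddCommGroup E] [NormedSpace ℝ E]
  {M : Type*} [TopologicalSpace M] [ChartedSpace E M] [IsManifold 𝓘(ℝ, E) ∞ M]
variable {x₀ x : M}

/-- Integral curves of smooth vector fields are smooth. -/
theorem contDiffOn_of_hasDerivAt_comp {F : Type*} [NormedAddCommGroup F] [NormedSpace ℝ F]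
    {V : F → F} {U : Set F} (hV : ∀ z ∈ U, ContDiffAt ℝ ∞ V z) {f : ℝ → F} {s : Set ℝ}
    (hs : IsOpen s) (hf : ∀ t ∈ s, HasDerivAt f (V (f t)) t) (hU : MapsTo f s U) :
    ContDiffOn ℝ ∞ f s := by
  refine contDiffOn_infty.2 fun n => ?_
  induction n with
  | zero => exact contDiffOn_zero.2 fun t ht => (hf t ht).continuousAt.continuousWithinAt
  | succ n ih =>
    rw [Nat.cast_succ, contDiffOn_succ_iff_deriv_of_isOpen hs]
    refine ⟨fun t ht => (hf t ht).differentiableAt.differentiableWithinAt, by simp, ?_⟩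
    have : ContDiffOn ℝ n (fun t => V (f t)) s := fun t ht =>
      ((hV _ (hU ht)).of_le (by exact_mod_cast le_top)).comp_contDiffWithinAt t (ih t ht)
    exact this.congr fun t ht => (hf t ht).deriv

theorem toCoord_eq_zero_iff (hx : x ∈ (chartAt E x₀).source) {v : TangentSpace 𝓘(ℝ, E) x} :
    toCoord x₀ x v = 0 ↔ v = 0 := by
  refine ⟨fun h => ?_, fun h => by rw [h]; exact map_zero _⟩
  rw [← ofCoord_toCoord hx v, h, map_zero]

theorem tangentChart_symm_mem_source {p : TangentBundle 𝓘(ℝ, E) M} {z : E × E}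
    (hz : z ∈ (extChartAt 𝓘(ℝ, E).tangent p).target) :
    ((extChartAt 𝓘(ℝ, E).tangent p).symm z).proj ∈ (chartAt E p.proj).source := by
  have := (extChartAt 𝓘(ℝ, E).tangent p).map_target hz
  rw [extChartAt_source] at this
  simpa using this

/-- The coordinates of the velocity of a curve in `TM` given in the chart at `p`. -/
theorem dcoord_velocity {p : TangentBundle 𝓘(ℝ, E) M} {f : ℝ → E × E} {t : ℝ} {v : E × E}
    (hf : HasDerivAt f v t) (ht : f t ∈ (extChartAt 𝓘(ℝ, E).tangent p).target)
    (hd : MDifferentiableAt 𝓘(ℝ, ℝ) 𝓘(ℝ, E).tangent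
      (fun t => (extChartAt 𝓘(ℝ, E).tangent p).symm (f t)) t) :
    dcoord p ((extChartAt 𝓘(ℝ, E).tangent p).symm (f t)) (velocity 𝓘(ℝ, E).tangent
      (fun t => (extChartAt 𝓘(ℝ, E).tangent p).symm (f t)) t).2 = v := by
  have hs := tangentChart_symm_mem_source ht
  have h1 := ((mdifferentiableAt_tangentChart hs).hasMFDerivAt.comp t hd.hasMFDerivAt)
  have h2 : HasMFDerivAt 𝓘(ℝ, ℝ) 𝓘(ℝ, E × E) (extChartAt 𝓘(ℝ, E).tangent p ∘
      fun t => (extChartAt 𝓘(ℝ, E).tangent p).symm (f t)) t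
      (ContinuousLinearMap.toSpanSingleton ℝ v) := by
    refine hf.hasFDerivAt.hasMFDerivAt.congr_of_eventuallyEq ?_
    filter_upwards [hf.continuousAt ((isOpen_extChartAt_target p).mem_nhds ht)] with s hs
    exact (extChartAt 𝓘(ℝ, E).tangent p).right_inv hs
  exact congr($(hasMFDerivAt_unique h1 h2) (1 : ℝ)).trans (one_smul ℝ v)

namespace LinearConnection
variable (nabla : LinearConnection E M)

theorem connector_eq_zero_of_mem_horizontalAt {u : TangentBundle 𝓘(ℝ, E) M}
    {ξ : TangentSpace 𝓘(ℝ, E).tangent u} (h : ξ ∈ nabla.horizontalAt u) :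
    nabla.connector u ξ = 0 := by
  obtain ⟨ε, γ, hε, hγ, hpar, hv⟩ := h
  have h0 : (0 : ℝ) ∈ Ioo (-ε) ε := ⟨by linarith, hε⟩
  have hγ0 := (hγ.contMDiffAt (isOpen_Ioo.mem_nhds h0)).mdifferentiableAt (by simp)
  have h1 := hpar 0 h0
  rw [nabla.derivAlong_eq_connector hγ0] at h1
  have key : ∀ X Y : TangentBundle 𝓘(ℝ, E).tangent (TangentBundle 𝓘(ℝ, E) M), X = Y →
      nabla.connector X.1 X.2 = 0 → nabla.connector Y.1 Y.2 = 0 := by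
    intro X Y h h'
    rw [← h]
    exact h'
  exact key (velocity 𝓘(ℝ, E).tangent γ 0) ⟨u, ξ⟩ hv h1

variable [FiniteDimensional ℝ E] [T2Space M] [nabla.ContMDiffCovariantDerivative ∞]

/-- Local solvability of the equation `c' = a`, `y' = -Γ_c(y, a)` of parallel transport along a
coordinate line. -/
theorem exists_parallel_coord (p : TangentBundle 𝓘(ℝ, E) M) (a : E) {z₀ : E × E}
    (hz₀ : z₀ ∈ (extChartAt 𝓘(ℝ, E).tangent p).target) :
    ∃ (ε : ℝ) (f : ℝ → E × E), 0 < ε ∧ f 0 = z₀ ∧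
      MapsTo f (Ioo (-ε) ε) (extChartAt 𝓘(ℝ, E).tangent p).target ∧
      ContDiffOn ℝ ∞ f (Ioo (-ε) ε) ∧ ∀ t ∈ Ioo (-ε) ε,
        HasDerivAt f (a, - nabla.christoffel p.proj (f t).1 (f t).2 a) t := by
  set Φ := extChartAt 𝓘(ℝ, E).tangent p with hΦ
  -- The vector field on `E × E` whose integral curves are the solutions.
  let V : E × E → E × E := fun z => (a, - nabla.christoffel p.proj z.1 z.2 a)
  have hV : ∀ z ∈ Φ.target, ContDiffAt ℝ ∞ V z := fun z hz => by
    have h := nabla.contDiffAt_christoffel (mem_tangentChart_target.1 hz)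
    have h' : ContDiffAt ℝ ∞ (fun z : E × E => nabla.christoffel p.proj z.1) z :=
      h.comp z contDiffAt_fst
    exact contDiffAt_const.prodMk ((h'.clm_apply contDiffAt_snd).clm_apply contDiffAt_const).neg
  obtain ⟨f, hf0, δ, hδ, hf⟩ :=
    ((hV _ hz₀).of_le (by exact_mod_cast
      le_top)).exists_forall_mem_closedBall_exists_eq_forall_mem_Ioo_hasDerivAt₀ (0 : ℝ)
  have hfc : ContinuousAt f 0 := (hf 0 ⟨by linarith, by linarith⟩).continuousAt
  have htar : ∀ᶠ t in 𝓝 (0 : ℝ), f t ∈ Φ.target :=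
    hfc ((isOpen_extChartAt_target p).mem_nhds (hf0 ▸ hz₀))
  obtain ⟨ε', hε', hball⟩ := Metric.eventually_nhds_iff.1 htar
  have hft : MapsTo f (Ioo (-min δ ε') (min δ ε')) Φ.target := fun t ht => hball (by
    rw [Real.dist_eq, sub_zero, abs_lt]
    exact ⟨by linarith [ht.1, min_le_right δ ε'], by linarith [ht.2, min_le_right δ ε']⟩)
  have hfd : ∀ t ∈ Ioo (-min δ ε') (min δ ε'), HasDerivAt f (V (f t)) t := fun t ht =>
    hf t ⟨by linarith [ht.1, min_le_left δ ε'], by linarith [ht.2, min_le_left δ ε']⟩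
  exact ⟨min δ ε', f, lt_min hδ hε', hf0, hft, contDiffOn_of_hasDerivAt_comp hV isOpen_Ioo hfd hft,
    hfd⟩

theorem mem_horizontalAt_of_connector_eq_zero {u : TangentBundle 𝓘(ℝ, E) M}
    {ξ : TangentSpace 𝓘(ℝ, E).tangent u} (hξ : nabla.connector u ξ = 0) :
    ξ ∈ nabla.horizontalAt u := by
  have hu : u.proj ∈ (chartAt E u.proj).source := by simp
  obtain ⟨ε, f, hε, hf0, hft, hfs, hfd⟩ :=
    nabla.exists_parallel_coord u (dcoord u u ξ).1 (mem_extChartAt_target (I := 𝓘(ℝ, E).tangent) u)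
  set Φ := extChartAt 𝓘(ℝ, E).tangent u with hΦ
  have hγ : ContMDiffOn 𝓘(ℝ, ℝ) 𝓘(ℝ, E).tangent ∞ (fun t => Φ.symm (f t)) (Ioo (-ε) ε) :=
    (contMDiffOn_extChartAt_symm u).comp hfs.contMDiffOn hft
  have hd : ∀ t ∈ Ioo (-ε) ε, MDifferentiableAt 𝓘(ℝ, ℝ) 𝓘(ℝ, E).tangent
      (fun t => Φ.symm (f t)) t := fun t ht =>
    (hγ.contMDiffAt (isOpen_Ioo.mem_nhds ht)).mdifferentiableAt (by simp)
  have h0 : (0 : ℝ) ∈ Ioo (-ε) ε := ⟨by linarith, hε⟩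
  refine ⟨ε, fun t => Φ.symm (f t), hε, hγ, fun t ht => ?_, ?_⟩
  · have hs := tangentChart_symm_mem_source (hft ht)
    have h1 := nabla.toCoord_connector hs (velocity 𝓘(ℝ, E).tangent (fun t => Φ.symm (f t)) t).2
    have h2 : Φ (Φ.symm (f t)) = f t := Φ.right_inv (hft ht)
    rw [hΦ, tangentChart_apply, trivializationAt_snd hs] at h2
    have h2a := congr_arg Prod.fst h2
    have h2b := congr_arg Prod.snd h2
    dsimp only at h2a h2b
    rw [nabla.derivAlong_eq_connector (hd t ht)]
    rw [dcoord_velocity (hfd t ht) (hft ht) (hd t ht), h2a, h2b] at h1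
    have h3 := h1.trans (neg_add_cancel _)
    exact (toCoord_eq_zero_iff hs).1 h3
  · have key : ∀ X : TangentBundle 𝓘(ℝ, E).tangent (TangentBundle 𝓘(ℝ, E) M), X.1 = u →
        dcoord u X.1 X.2 = dcoord u u ξ → X = ⟨u, ξ⟩ := by
      rintro ⟨w, ζ⟩ h h'
      obtain rfl : w = u := h
      exact congr_arg _ ((dcoord_bijective hu).1 h')
    have hfu : Φ.symm (f 0) = u := by rw [hf0]; exact extChartAt_to_inv u
    refine key (velocity 𝓘(ℝ, E).tangent (fun t => Φ.symm (f t)) 0) hfu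
      ((dcoord_velocity (hfd 0 h0) (hft h0) (hd 0 h0)).trans ?_)
    have h1 := nabla.toCoord_connector hu ξ
    rw [hξ, map_zero] at h1
    rw [hf0, hΦ, tangentChart_apply, trivializationAt_snd hu]
    exact Prod.ext rfl (eq_neg_of_add_eq_zero_left h1.symm).symm

theorem mem_horizontalAt_iff {u : TangentBundle 𝓘(ℝ, E) M} {ξ : TangentSpace 𝓘(ℝ, E).tangent u} :
    ξ ∈ nabla.horizontalAt u ↔ nabla.connector u ξ = 0 :=
  ⟨nabla.connector_eq_zero_of_mem_horizontalAt, nabla.mem_horizontalAt_of_connector_eq_zero⟩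
end LinearConnection

end

/-! ### The lift as an explicit two-form -/

section

section
variable {W : Type*} [NormedAddCommGroup W] [NormedSpace ℝ W]
/-- A linear form, regarded as an alternating `1`-form. -/
def oneForm (W : Type*) [NormedAddCommGroup W] [NormedSpace ℝ W] :
    (W →L[ℝ] ℝ) →L[ℝ] (W [⋀^Fin 1]→L[ℝ] ℝ) :=
  (ContinuousAlternatingMap.ofSubsingletonLIE (𝕜 := ℝ) (E := W) (F := ℝ)
    (0 : Fin 1)).toContinuousLinearEquiv

theorem oneForm_apply (f : W →L[ℝ] ℝ) (v : Fin 1 → W) : oneForm W f v = f (v 0) := rfl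

/-- The alternating form `(v, w) ↦ B(v, w) - B(w, v)`. -/
def skewForm (W : Type*) [NormedAddCommGroup W] [NormedSpace ℝ W] :
    (W →L[ℝ] W →L[ℝ] ℝ) →L[ℝ] (W [⋀^Fin 2]→L[ℝ] ℝ) :=
  (ContinuousAlternatingMap.alternatizeUncurryFinCLM ℝ W ℝ).comp
    (ContinuousLinearMap.postcomp W (oneForm W))

theorem skewForm_apply (B : W →L[ℝ] W →L[ℝ] ℝ) (v : Fin 2 → W) :
    skewForm W B v = B (v 0) (v 1) - B (v 1) (v 0) := by
  have h := ContinuousAlternatingMap.alternatizeUncurryFin_apply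
    ((ContinuousLinearMap.postcomp W (oneForm W)) B) v
  refine h.trans ?_
  rw [Fin.sum_univ_two]
  simp [oneForm_apply, Fin.removeNth, Fin.tail, sub_eq_add_neg]

theorem contDiffAt_oneForm {D : Type*} [NormedAddCommGroup D] [NormedSpace ℝ D]
    {f : D → W →L[ℝ] ℝ} {z : D} {n : ℕ∞ω} (h : ContDiffAt ℝ n f z) :
    ContDiffAt ℝ n (fun w => oneForm W (f w)) z :=
  h.continuousLinearMap_comp (oneForm W)

set_option synthInstance.maxHeartbeats 200000 in
theorem contDiffAt_skewForm {D : Type*} [NormedAddCommGroup D] [NormedSpace ℝ D]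
    {f : D → W →L[ℝ] W →L[ℝ] ℝ} {z : D} {n : ℕ∞ω} (h : ContDiffAt ℝ n f z) :
    ContDiffAt ℝ n (fun w => skewForm W (f w)) z := by
  have := ContDiffAt.continuousLinearMap_comp (G := W [⋀^Fin 2]→L[ℝ] ℝ) (skewForm W) h
  exact this

end

section
variable {W : Type*} [AddCommGroup W] [Module ℝ W] [TopologicalSpace W]

theorem ContinuousAlternatingMap.ext_fin_two {f g : W [⋀^Fin 2]→L[ℝ] ℝ}
    (h : ∀ v w, f ![v, w] = g ![v, w]) : f = g := by
  ext v
  have : v = ![v 0, v 1] := by ext i; fin_cases i <;> rfl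
  rw [this, h]

theorem ContinuousAlternatingMap.fin_two_swap (f : W [⋀^Fin 2]→L[ℝ] ℝ) (v w : W) :
    f ![v, w] = - f ![w, v] := by
  have h := f.toAlternatingMap.map_swap ![w, v] (i := 0) (j := 1) (by simp)
  have h2 : (![w, v] ∘ Equiv.swap (0 : Fin 2) 1) = ![v, w] := by
    ext i; fin_cases i <;> rfl
  rw [h2] at h
  exact h

theorem ContinuousAlternatingMap.fin_two_add_add (f : W [⋀^Fin 2]→L[ℝ] ℝ) (a b c d : W) :
    f ![a + b, c + d] = f ![a, c] + f ![a, d] + f ![b, c] + f ![b, d] := by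
  rw [f.vecCons_add, f.fin_two_swap a, f.fin_two_swap b, f.vecCons_add, f.vecCons_add,
    f.fin_two_swap c, f.fin_two_swap d, f.fin_two_swap c, f.fin_two_swap d]
  ring
end

variable {E : Type*} [NormedAddCommGroup E] [NormedSpace ℝ E]
  {M : Type*} [TopologicalSpace M] [ChartedSpace E M] [IsManifold 𝓘(ℝ, E) ∞ M]
variable {x₀ x : M}

/-- The bilinear form `((a, b), (c, d)) ↦ B(b + g a, c)`; `skewForm` turns it into the expression of
the lift in a chart, with `g` standing for `Γ(y, ·)`. -/
def liftModel (B : E →L[ℝ] E →L[ℝ] ℝ) (g : E →L[ℝ] E) : (E × E) →L[ℝ] (E × E) →L[ℝ] ℝ :=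
  B.bilinearComp (ContinuousLinearMap.snd ℝ E E + g.comp (ContinuousLinearMap.fst ℝ E E))
    (ContinuousLinearMap.fst ℝ E E)

theorem liftModel_apply (B : E →L[ℝ] E →L[ℝ] ℝ) (g : E →L[ℝ] E) (ζ η : E × E) :
    liftModel B g ζ η = B (ζ.2 + g ζ.1) η.1 := rfl

variable [FiniteDimensional ℝ E]
namespace LinearConnection
variable (nabla : LinearConnection E M) (A : Tensor20 E M)

/-- The lift of `(∇, 0, 0, A)`, defined by means of the chart at each point. Its intrinsic
expression is `liftForm_apply`. -/
def liftForm : DiffForm 𝓘(ℝ, E).tangent (TangentBundle 𝓘(ℝ, E) M) 2 := fun u =>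
  (skewForm (E × E) (liftModel (A.coord u.proj (extChartAt 𝓘(ℝ, E) u.proj u.proj))
    (nabla.christoffel u.proj (extChartAt 𝓘(ℝ, E) u.proj u.proj) (toCoord u.proj u.proj u.2)))
    ).compContinuousLinearMap (dcoord u u)

theorem liftForm_apply (u : TangentBundle 𝓘(ℝ, E) M) (ξ η : TangentSpace 𝓘(ℝ, E).tangent u) :
    nabla.liftForm A u ![ξ, η] = A u.proj (nabla.connector u ξ) (dproj u η) -
      A u.proj (nabla.connector u η) (dproj u ξ) := by
  have hu : u.proj ∈ (chartAt E u.proj).source := by simp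
  refine (skewForm_apply _ _).trans ?_
  rw [← A.coord_toCoord hu (nabla.connector u ξ), ← A.coord_toCoord hu (nabla.connector u η),
    nabla.toCoord_connector hu, nabla.toCoord_connector hu, ← dcoord_fst hu, ← dcoord_fst hu]
  rfl

theorem liftForm_inChart (p : TangentBundle 𝓘(ℝ, E) M) {z : E × E}
    (hz : z ∈ (extChartAt 𝓘(ℝ, E).tangent p).target) :
    (nabla.liftForm A).inChart p z = skewForm (E × E) (liftModel (A.coord p.proj z.1)
      (nabla.christoffel p.proj z.1 z.2)) := by
  have hs := tangentChart_symm_mem_source hz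
  refine ContinuousAlternatingMap.ext_fin_two fun ζ η => ?_
  have key : ∀ (u : TangentBundle 𝓘(ℝ, E) M), u.proj ∈ (chartAt E p.proj).source →
      extChartAt 𝓘(ℝ, E).tangent p u = z → ∀ ξ₁ ξ₂ : TangentSpace 𝓘(ℝ, E).tangent u,
      dcoord p u ξ₁ = ζ → dcoord p u ξ₂ = η → nabla.liftForm A u ![ξ₁, ξ₂] =
      skewForm (E × E) (liftModel (A.coord p.proj z.1)
      (nabla.christoffel p.proj z.1 z.2)) ![ζ, η] := by
    intro u hu hz ξ₁ ξ₂ h1 h2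
    rw [tangentChart_apply, trivializationAt_snd hu] at hz
    rw [liftForm_apply, ← A.coord_toCoord hu (nabla.connector u ξ₁),
      ← A.coord_toCoord hu (nabla.connector u ξ₂),
      nabla.toCoord_connector hu, nabla.toCoord_connector hu, ← dcoord_fst hu, ← dcoord_fst hu,
      h1, h2, skewForm_apply, ← hz]
    rfl
  have h := key _ hs ((extChartAt 𝓘(ℝ, E).tangent p).right_inv hz) _ _ (dcoord_symm hz ζ)
    (dcoord_symm hz η)
  refine Eq.trans ?_ h
  refine congr_arg (nabla.liftForm A _) ?_
  ext i; fin_cases i <;> rfl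

variable [T2Space M] [nabla.ContMDiffCovariantDerivative ∞]

theorem isLift_liftForm : nabla.IsLift 0 0 A (nabla.liftForm A) where
  vert_vert u v w := by
    rw [liftForm_apply, dproj_vertLift, dproj_vertLift, map_zero, map_zero, sub_zero]; rfl
  hor_hor u ξ hξ η hη := by
    rw [liftForm_apply, nabla.mem_horizontalAt_iff.1 hξ, nabla.mem_horizontalAt_iff.1 hη, map_zero]
    exact sub_zero _
  vert_hor u v η hη := by
    rw [liftForm_apply, nabla.mem_horizontalAt_iff.1 hη, connector_vertLift, map_zero]
    exact sub_zero _
  hor_vert u ξ hξ w := by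
    rw [liftForm_apply, nabla.mem_horizontalAt_iff.1 hξ, connector_vertLift, map_zero]
    exact zero_sub _

variable {nabla A} in
/-- Uniqueness of the lift: every `ξ` is the sum of the vertical lift of `K ξ` and of a horizontal
vector. -/
theorem IsLift.eq_liftForm {Ω : DiffForm 𝓘(ℝ, E).tangent (TangentBundle 𝓘(ℝ, E) M) 2}
    (h : nabla.IsLift 0 0 A Ω) : Ω = nabla.liftForm A := by
  have h' := nabla.isLift_liftForm A
  funext u
  refine ContinuousAlternatingMap.ext_fin_two fun ξ η => ?_
  have hor : ∀ ξ : TangentSpace 𝓘(ℝ, E).tangent u,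
      ξ - vertLift u (nabla.connector u ξ) ∈ nabla.horizontalAt u := fun ξ => by
    rw [mem_horizontalAt_iff, map_sub, connector_vertLift, sub_self]
  rw [← add_sub_cancel (vertLift u (nabla.connector u ξ)) ξ,
    ← add_sub_cancel (vertLift u (nabla.connector u η)) η,
    ContinuousAlternatingMap.fin_two_add_add, ContinuousAlternatingMap.fin_two_add_add,
    h.vert_vert, h.vert_hor _ _ _ (hor η), h.hor_vert _ _ (hor ξ), h.hor_hor _ _ (hor ξ) _ (hor η),
    h'.vert_vert, h'.vert_hor _ _ _ (hor η), h'.hor_vert _ _ (hor ξ),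
    h'.hor_hor _ _ (hor ξ) _ (hor η)]

end LinearConnection

omit [IsManifold 𝓘(ℝ, E) ∞ M] in
theorem Tensor20.Nondegenerate.bijective {A : Tensor20 E M} (hA : A.Nondegenerate) (x : M) :
    Function.Bijective (A x) := by
  have key : ∀ B : E →L[ℝ] E →L[ℝ] ℝ, (∀ u, (∀ v, B u v = 0) → u = 0) → Function.Bijective B := by
    intro B hB
    have hinj : Function.Injective (B : E →ₗ[ℝ] E →L[ℝ] ℝ) :=
      (injective_iff_map_eq_zero _).2 fun u hu => hB u fun v => congr($hu v)
    have hdim : Module.finrank ℝ E = Module.finrank ℝ (E →L[ℝ] ℝ) := by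
      rw [← Subspace.dual_finrank_eq]
      exact (LinearMap.toContinuousLinearMap (𝕜 := ℝ) (E := E) (F' := ℝ)).finrank_eq
    exact ⟨hinj, (LinearMap.injective_iff_surjective_of_finrank_eq_finrank hdim).1 hinj⟩
  exact key (A x) (hA x)

omit [IsManifold 𝓘(ℝ, E) ∞ M] in
theorem Tensor20.Nondegenerate.right {A : Tensor20 E M} (hA : A.Nondegenerate) {x : M}
    {w : TangentSpace 𝓘(ℝ, E) x} (h : ∀ v, A x v w = 0) : w = 0 := by
  have h2 : ∀ f : E →L[ℝ] ℝ, f w = 0 := fun f => by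
    obtain ⟨v, hv⟩ := (hA.bijective x).2 f
    exact hv ▸ h v
  exact SeparatingDual.eq_zero_of_forall_dual_eq_zero (R := ℝ) (V := E) h2

variable {nabla : LinearConnection E M} {A : Tensor20 E M}

theorem LinearConnection.liftForm_nondegenerate (hA : A.Nondegenerate)
    {u : TangentBundle 𝓘(ℝ, E) M} {ξ : TangentSpace 𝓘(ℝ, E).tangent u}
    (h : ∀ η, nabla.liftForm A u ![ξ, η] = 0) : ξ = 0 := by
  have h1 : dproj u ξ = 0 := hA.right fun v => by
    have := h (vertLift u v)
    rw [liftForm_apply, dproj_vertLift, map_zero, connector_vertLift, zero_sub, neg_eq_zero] at this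
    exact this
  apply (nabla.dproj_connector_bijective u).1
  refine Prod.ext (h1.trans (map_zero _).symm) (Eq.trans ?_ (map_zero _).symm)
  refine hA _ _ fun v => ?_
  obtain ⟨η, hη⟩ := (nabla.dproj_connector_bijective u).2 (v, 0)
  have hη1 : dproj u η = v := congr($hη.1)
  have := h η
  rw [liftForm_apply, h1, map_zero, sub_zero, hη1] at this
  exact this

variable [T2Space M] [nabla.ContMDiffCovariantDerivative ∞]

theorem LinearConnection.isSmooth_liftForm (hA : A.IsSmooth) : (nabla.liftForm A).IsSmooth := by
  intro p z hz
  refine ContDiffAt.contDiffWithinAt ?_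
  have h1 : (nabla.liftForm A).inChart p =ᶠ[𝓝 z] fun z =>
      skewForm (E × E) (liftModel (A.coord p.proj z.1) (nabla.christoffel p.proj z.1 z.2)) := by
    filter_upwards [(isOpen_extChartAt_target p).mem_nhds hz] with z hz
    exact nabla.liftForm_inChart A p hz
  refine ContDiffAt.congr_of_eventuallyEq ?_ h1
  refine contDiffAt_skewForm ?_
  have hz1 := mem_tangentChart_target.1 hz
  have hΓ : ContDiffAt ℝ ∞ (fun z : E × E => nabla.christoffel p.proj z.1) z :=
    (nabla.contDiffAt_christoffel hz1).comp z contDiffAt_fst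
  have hA' : ContDiffAt ℝ ∞ (fun z : E × E => A.coord p.proj z.1) z :=
    (hA.contDiffAt_coord hz1).comp z contDiffAt_fst
  refine contDiffAt_clm_apply_iff.2 fun ζ => contDiffAt_clm_apply_iff.2 fun η => ?_
  exact (hA'.clm_apply (contDiffAt_const.add ((hΓ.clm_apply contDiffAt_snd).clm_apply
    contDiffAt_const))).clm_apply contDiffAt_const

end

/-! ### The Codazzi equation in coordinates -/

section

variable {E : Type*} [NormedAddCommGroup E] [NormedSpace ℝ E]
  {M : Type*} [TopologicalSpace M] [ChartedSpace E M] [IsManifold 𝓘(ℝ, E) ∞ M]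
variable {x₀ x : M}

/-- The expression of a vector field in a chart. -/
def vectorCoord (x₀ : M) (σ : (x : M) → TangentSpace 𝓘(ℝ, E) x) (z : E) : E :=
  coordRep x₀ σ ((extChartAt 𝓘(ℝ, E) x₀).symm z)

omit [IsManifold 𝓘(ℝ, E) ∞ M] in
theorem extChartAt_symm_extChartAt (hx : x ∈ (chartAt E x₀).source) :
    (extChartAt 𝓘(ℝ, E) x₀).symm (extChartAt 𝓘(ℝ, E) x₀ x) = x :=
  (extChartAt 𝓘(ℝ, E) x₀).left_inv (by simpa using hx)

omit [IsManifold 𝓘(ℝ, E) ∞ M] in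
theorem extChartAt_mem_target (hx : x ∈ (chartAt E x₀).source) :
    extChartAt 𝓘(ℝ, E) x₀ x ∈ (extChartAt 𝓘(ℝ, E) x₀).target :=
  (extChartAt 𝓘(ℝ, E) x₀).map_source (by simpa using hx)

theorem vectorCoord_extChartAt (hx : x ∈ (chartAt E x₀).source)
    (σ : (x : M) → TangentSpace 𝓘(ℝ, E) x) :
    vectorCoord x₀ σ (extChartAt 𝓘(ℝ, E) x₀ x) = toCoord x₀ x (σ x) := by
  rw [vectorCoord, extChartAt_symm_extChartAt hx]; rfl

theorem SmoothVectorField.contDiffAt_vectorCoord {σ : (x : M) → TangentSpace 𝓘(ℝ, E) x}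
    (hσ : SmoothVectorField σ) {z : E} (hz : z ∈ (extChartAt 𝓘(ℝ, E) x₀).target) :
    ContDiffAt ℝ ∞ (vectorCoord x₀ σ) z :=
  contDiffAt_comp_symm hz ((contMDiffAt_section_iff_coordRep (symm_mem_source hz) σ).1 (hσ _))

/-- The derivative of a function on `M` computed from its expression `g` in the chart at `x₀`. -/
theorem mvfderiv_eq_of_hasFDerivAt {F : Type*} [NormedAddCommGroup F] [NormedSpace ℝ F]
    (hx : x ∈ (chartAt E x₀).source) {f : M → F} {g : E → F} {g' : E →L[ℝ] F}
    (hg : HasFDerivAt g g' (extChartAt 𝓘(ℝ, E) x₀ x))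
    (v : TangentSpace 𝓘(ℝ, E) x)
    (hfg : ∀ y ∈ (chartAt E x₀).source, f y = g (extChartAt 𝓘(ℝ, E) x₀ y)) :
    mvfderiv 𝓘(ℝ, E) f x v = g' (toCoord x₀ x v) := by
  have h4 := mfderiv_extChartAt_eq_toCoord hx
  have h1 : HasMFDerivAt 𝓘(ℝ, E) 𝓘(ℝ, F) (g ∘ extChartAt 𝓘(ℝ, E) x₀) x
      (g'.comp (toCoord x₀ x) : TangentSpace 𝓘(ℝ, E) x →L[ℝ] F) :=
    h4 ▸ hg.hasMFDerivAt.comp x (mdifferentiableAt_extChartAt hx).hasMFDerivAt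
  have h2 := h1.congr_of_eventuallyEq (f₁ := f) (by
    filter_upwards [(chartAt E x₀).open_source.mem_nhds hx] with y hy using hfg y hy)
  exact congr($(h2.mfderiv) v)

theorem toCoord_mlieBracket [FiniteDimensional ℝ E] (hx : x ∈ (chartAt E x₀).source)
    {X Y : (x : M) → TangentSpace 𝓘(ℝ, E) x} (hX : SmoothVectorField X) (hY : SmoothVectorField Y) :
    toCoord x₀ x (VectorField.mlieBracket 𝓘(ℝ, E) X Y x) =
      fderiv ℝ (vectorCoord x₀ Y) (extChartAt 𝓘(ℝ, E) x₀ x) (toCoord x₀ x (X x)) -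
      fderiv ℝ (vectorCoord x₀ X) (extChartAt 𝓘(ℝ, E) x₀ x) (toCoord x₀ x (Y x)) := by
  have h2 : minSmoothness ℝ 2 ≤ ∞ := by
    rw [minSmoothness_of_isRCLikeNormedField]; exact WithTop.coe_le_coe.2 (le_top (a := (2 : ℕ∞)))
  have : IsManifold 𝓘(ℝ, E) (minSmoothness ℝ 2) M := IsManifold.of_le (n := ∞) h2
  have : CompleteSpace E := FiniteDimensional.complete ℝ E
  have hpull : ∀ σ : (x : M) → TangentSpace 𝓘(ℝ, E) x,
      σ =ᶠ[𝓝 x] VectorField.mpullback 𝓘(ℝ, E) 𝓘(ℝ, E) (extChartAt 𝓘(ℝ, E) x₀)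
        (vectorCoord x₀ σ) := fun σ => by
    filter_upwards [(chartAt E x₀).open_source.mem_nhds hx] with y hy
    refine Eq.trans ?_ (VectorField.mpullback_apply (I := 𝓘(ℝ, E)) (I' := 𝓘(ℝ, E))).symm
    rw [vectorCoord_extChartAt hy]
    have h5 := isInvertible_mfderiv_extChartAt (I := 𝓘(ℝ, E)) (x := x₀) (y := y)
      (by simpa using hy)
    have h6 : toCoord x₀ y (σ y) = mfderiv 𝓘(ℝ, E) 𝓘(ℝ, E) (extChartAt 𝓘(ℝ, E) x₀) y (σ y) :=
      congr($((mfderiv_extChartAt_eq_toCoord hy).symm) (σ y))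
    rw [h6]
    exact (h5.inverse_apply_self _).symm
  have hd : ∀ {σ : (x : M) → TangentSpace 𝓘(ℝ, E) x}, SmoothVectorField σ →
      MDifferentiableAt 𝓘(ℝ, E) 𝓘(ℝ, E).tangent (fun z : E => TotalSpace.mk' E
        (E := (TangentSpace 𝓘(ℝ, E) : E → Type _)) z (vectorCoord (E := E) x₀ σ z))
        (extChartAt 𝓘(ℝ, E) x₀ x) := fun hσ =>
      (contMDiffAt_vectorSpace_iff_contDiffAt.2 (hσ.contDiffAt_vectorCoord
        (extChartAt_mem_target hx))).mdifferentiableAt (by simp)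
  rw [Filter.EventuallyEq.mlieBracket_vectorField_eq (hpull X) (hpull Y),
    ← VectorField.mpullback_mlieBracket (n := ∞) (hd hX) (hd hY) (contMDiffAt_extChartAt' hx)
      h2, VectorField.mpullback_apply]
  have h5 := (isInvertible_mfderiv_extChartAt (I := 𝓘(ℝ, E)) (x := x₀) (y := x) (by simpa using hx))
  have h6 : ∀ w, toCoord x₀ x ((mfderiv 𝓘(ℝ, E) 𝓘(ℝ, E) (extChartAt 𝓘(ℝ, E) x₀) x).inverse w) = w :=
    fun w => by
      rw [← mfderiv_extChartAt_eq_toCoord hx]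
      exact h5.self_apply_inverse _
  rw [h6, ← vectorCoord_extChartAt hx, ← vectorCoord_extChartAt hx]
  have key : ∀ V W : E → E, VectorField.mlieBracket 𝓘(ℝ, E) (M := E) V W =
      VectorField.lieBracket ℝ V W := fun V W =>
    (VectorField.mlieBracketWithin_univ (I := 𝓘(ℝ, E)) (M := E)).symm.trans
      (VectorField.mlieBracketWithin_eq_lieBracketWithin.trans VectorField.lieBracketWithin_univ)
  exact congr_fun (key _ _) _

variable [FiniteDimensional ℝ E]
namespace LinearConnection
variable (nabla : LinearConnection E M) (A : Tensor20 E M)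

/-- The defect of the Codazzi equation in the chart at `x₀`, at the point with coordinates `z`:
`∂_a A(y, c) - A(Γ(y, a), c) - (∂_c A(y, a) - A(Γ(y, c), a))`. -/
def codazziCoord (x₀ : M) (z y a c : E) : ℝ :=
  fderiv ℝ (A.coord x₀) z a y c - A.coord x₀ z (nabla.christoffel x₀ z y a) c -
    (fderiv ℝ (A.coord x₀) z c y a - A.coord x₀ z (nabla.christoffel x₀ z y c) a)

variable {A} in
theorem mvfderiv_tensor (hA : A.IsSmooth) (hx : x ∈ (chartAt E x₀).source)
    {Y Z : (x : M) → TangentSpace 𝓘(ℝ, E) x} (hY : SmoothVectorField Y) (hZ : SmoothVectorField Z)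
    (v : TangentSpace 𝓘(ℝ, E) x) :
    mvfderiv 𝓘(ℝ, E) (fun y => A y (Z y) (Y y)) x v =
      fderiv ℝ (A.coord x₀) (extChartAt 𝓘(ℝ, E) x₀ x) (toCoord x₀ x v) (toCoord x₀ x (Z x))
          (toCoord x₀ x (Y x)) +
        A.coord x₀ (extChartAt 𝓘(ℝ, E) x₀ x) (fderiv ℝ (vectorCoord x₀ Z) (extChartAt 𝓘(ℝ, E) x₀ x)
          (toCoord x₀ x v)) (toCoord x₀ x (Y x)) +
        A.coord x₀ (extChartAt 𝓘(ℝ, E) x₀ x) (toCoord x₀ x (Z x))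
          (fderiv ℝ (vectorCoord x₀ Y) (extChartAt 𝓘(ℝ, E) x₀ x) (toCoord x₀ x v)) := by
  have ht := extChartAt_mem_target hx
  have h1 := ((hA.contDiffAt_coord ht).differentiableAt (by simp)).hasFDerivAt
  have h2 := ((hY.contDiffAt_vectorCoord ht).differentiableAt (by simp)).hasFDerivAt
  have h3 := ((hZ.contDiffAt_vectorCoord ht).differentiableAt (by simp)).hasFDerivAt
  rw [mvfderiv_eq_of_hasFDerivAt hx ((h1.clm_apply h3).clm_apply h2) v fun y hy => by
    rw [vectorCoord_extChartAt hy, vectorCoord_extChartAt hy, A.coord_toCoord hy]]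
  simp only [vectorCoord_extChartAt hx, add_apply, ContinuousLinearMap.comp_apply,
    ContinuousLinearMap.flip_apply]
  ring

variable {nabla A} in
/-- The derivatives of the components of `X` and `Y` and the terms `A(Z, ∇_X Y)`, `A(Z, ∇_Y X)`
cancel against `A(Z, τ(X, Y))`, which leaves an expression that is tensorial in `X`, `Y`, `Z`. -/
theorem codazzi_eq_codazziCoord (hA : A.IsSmooth) (hx : x ∈ (chartAt E x₀).source)
    {X Y Z : (x : M) → TangentSpace 𝓘(ℝ, E) x} (hX : SmoothVectorField X) (hY : SmoothVectorField Y)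
    (hZ : SmoothVectorField Z) :
    nabla.derivTensor A X Z Y x - nabla.derivTensor A Y Z X x - A x (Z x) (nabla.tau X Y x) =
      nabla.codazziCoord A x₀ (extChartAt 𝓘(ℝ, E) x₀ x) (toCoord x₀ x (Z x)) (toCoord x₀ x (X x))
        (toCoord x₀ x (Y x)) := by
  have ht := extChartAt_mem_target hx
  have h3 := ((hZ.contDiffAt_vectorCoord ht).differentiableAt (by simp)).hasFDerivAt
  have hN : ∀ v, toCoord x₀ x (nabla Z x v) = fderiv ℝ (vectorCoord x₀ Z) (extChartAt 𝓘(ℝ, E) x₀ x)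
      (toCoord x₀ x v) + nabla.christoffel x₀ (extChartAt 𝓘(ℝ, E) x₀ x) (toCoord x₀ x (Z x))
        (toCoord x₀ x v) := fun v => by
    rw [nabla.toCoord_apply hx ((hZ x).mdifferentiableAt (by simp)),
      mvfderiv_eq_of_hasFDerivAt (f := coordRep x₀ Z) hx h3 v fun y hy =>
        (vectorCoord_extChartAt hy Z).symm]
  have hA' := A.coord_toCoord hx (Z x) (VectorField.mlieBracket 𝓘(ℝ, E) X Y x)
  rw [toCoord_mlieBracket hx hX hY, map_sub] at hA'
  have hA1 := A.coord_toCoord hx (nabla Z x (X x)) (Y x)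
  have hA2 := A.coord_toCoord hx (nabla Z x (Y x)) (X x)
  rw [hN, map_add, add_apply] at hA1 hA2
  rw [derivTensor, derivTensor, tau, mvfderiv_tensor hA hx hY hZ, mvfderiv_tensor hA hx hX hZ,
    codazziCoord, map_add, map_sub]
  linear_combination hA' + hA1 - hA2

variable {nabla A} in
theorem Codazzi.codazziCoord_eq_zero [T2Space M] (h : nabla.Codazzi A) (hA : A.IsSmooth) {z : E}
    (hz : z ∈ (extChartAt 𝓘(ℝ, E) x₀).target) (y a c : E) :
    nabla.codazziCoord A x₀ z y a c = 0 := by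
  have hs := symm_mem_source hz
  have hval : ∀ y, ∃ σ : (x : M) → TangentSpace 𝓘(ℝ, E) x, SmoothVectorField σ ∧
      toCoord x₀ _ (σ ((extChartAt 𝓘(ℝ, E) x₀).symm z)) = y := fun y => by
    obtain ⟨σ, hσ, hσ'⟩ := exists_smoothVectorField_eventuallyEq hs y
    exact ⟨σ, hσ, by rw [hσ'.self_of_nhds, toCoord_ofCoord hs]⟩
  obtain ⟨Z, hZ, hZ'⟩ := hval y
  obtain ⟨X, hX, hX'⟩ := hval a
  obtain ⟨Y, hY, hY'⟩ := hval c
  have := codazzi_eq_codazziCoord (nabla := nabla) hA hs hX hY hZ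
  rw [hZ', hX', hY', (extChartAt 𝓘(ℝ, E) x₀).right_inv hz, h X Y Z hX hY hZ, sub_self] at this
  exact this.symm

variable {nabla A} in
theorem codazzi_of_codazziCoord_eq_zero (hA : A.IsSmooth)
    (h : ∀ (x : M) (y a c : E), nabla.codazziCoord A x (extChartAt 𝓘(ℝ, E) x x) y a c = 0) :
    nabla.Codazzi A := fun X Y Z hX hY hZ x => by
  have := codazzi_eq_codazziCoord (nabla := nabla) hA (mem_chart_source E x) hX hY hZ
  rw [h] at this
  exact sub_eq_zero.1 this

end LinearConnection

end

/-! ### Closedness of the lift -/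

section

theorem extDeriv_oneForm {W : Type*} [NormedAddCommGroup W] [NormedSpace ℝ W]
    {f : W → W →L[ℝ] ℝ} {f' : W →L[ℝ] W →L[ℝ] ℝ} {z : W} (h : HasFDerivAt f f' z) :
    extDeriv (fun z => oneForm W (f z)) z = skewForm W f' := by
  have h1 : HasFDerivAt (fun z => oneForm W (f z)) ((oneForm W).comp f') z :=
    (oneForm W).hasFDerivAt.comp z h
  rw [extDeriv, h1.fderiv]
  rfl

theorem DiffForm.d_apply {V : Type*} [NormedAddCommGroup V] [NormedSpace ℝ V]
    {H : Type*} [TopologicalSpace H] {J : ModelWithCorners ℝ V H} [J.Boundaryless]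
    {N : Type*} [TopologicalSpace N] [ChartedSpace H N] {k : ℕ} (θ : DiffForm J N k) (p : N) :
    θ.d p = (extDeriv (θ.inChart p) (extChartAt J p p)).compContinuousLinearMap
      (mfderiv J 𝓘(ℝ, V) (extChartAt J p) p : TangentSpace J p →L[ℝ] V) := by
  rw [d, J.range_eq_univ, extDerivWithin_univ]

variable {E : Type*} [NormedAddCommGroup E] [NormedSpace ℝ E]
  {M : Type*} [TopologicalSpace M] [ChartedSpace E M] [IsManifold 𝓘(ℝ, E) ∞ M]
variable {x₀ x : M}

/-- The `1`-form `B_x(y, dx)` on `E × E`, at the point `z = (x, y)`. -/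
def flatPrimitive (B : E → E →L[ℝ] E →L[ℝ] ℝ) (z : E × E) : (E × E) →L[ℝ] ℝ :=
  (B z.1 z.2).comp (ContinuousLinearMap.fst ℝ E E)

/-- The derivative of `flatPrimitive`, in terms of the value `B` and the derivative `B'` of the
field of bilinear forms. -/
def flatPrimitiveDeriv (B : E →L[ℝ] E →L[ℝ] ℝ) (B' : E →L[ℝ] E →L[ℝ] E →L[ℝ] ℝ) (y : E) :
    (E × E) →L[ℝ] (E × E) →L[ℝ] ℝ :=
  ((ContinuousLinearMap.compL ℝ (E × E) E ℝ).flip (ContinuousLinearMap.fst ℝ E E)).comp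
    (B.comp (ContinuousLinearMap.snd ℝ E E) + (B'.comp (ContinuousLinearMap.fst ℝ E E)).flip y)

theorem flatPrimitiveDeriv_apply (B : E →L[ℝ] E →L[ℝ] ℝ) (B' : E →L[ℝ] E →L[ℝ] E →L[ℝ] ℝ) (y : E)
    (ζ η : E × E) :
    flatPrimitiveDeriv B B' y ζ η = B ζ.2 η.1 + B' ζ.1 y η.1 := rfl

theorem hasFDerivAt_comp_fst {F F' : Type*} [NormedAddCommGroup F] [NormedSpace ℝ F]
    [NormedAddCommGroup F'] [NormedSpace ℝ F'] {g : E → F} {z : E × F'}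
    (hg : DifferentiableAt ℝ g z.1) : HasFDerivAt (fun w : E × F' => g w.1)
      ((fderiv ℝ g z.1).comp (ContinuousLinearMap.fst ℝ E F')) z :=
  hg.hasFDerivAt.comp (f := Prod.fst) z hasFDerivAt_fst

theorem hasFDerivAt_flatPrimitive {B : E → E →L[ℝ] E →L[ℝ] ℝ} {z : E × E}
    (hB : DifferentiableAt ℝ B z.1) : HasFDerivAt (flatPrimitive B)
      (flatPrimitiveDeriv (B z.1) (fderiv ℝ B z.1) z.2) z := by
  have h1 := hasFDerivAt_comp_fst (g := B) (z := z) hB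
  have h2 := h1.clm_apply (hasFDerivAt_snd (𝕜 := ℝ) (E := E) (F := E) (p := z))
  exact ((ContinuousLinearMap.compL ℝ (E × E) E ℝ).flip
    (ContinuousLinearMap.fst ℝ E E)).hasFDerivAt.comp z h2

/-- The exterior derivative of the expression of the lift in a chart, evaluated on a coordinate
vector of the fibre and two coordinate vectors of the base. -/
theorem extDeriv_skewForm_liftModel {B : E → E →L[ℝ] E →L[ℝ] ℝ} {G : E → E →L[ℝ] E →L[ℝ] E}
    {z : E × E} (hB : DifferentiableAt ℝ B z.1) (hG : DifferentiableAt ℝ G z.1)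
    (hω : DifferentiableAt ℝ (fun z : E × E => skewForm (E × E) (liftModel (B z.1) (G z.1 z.2))) z)
    (w a c : E) :
    extDeriv (fun z : E × E => skewForm (E × E) (liftModel (B z.1) (G z.1 z.2))) z
      ![(0, w), (a, 0), (c, 0)] =
      B z.1 (G z.1 w a) c - B z.1 (G z.1 w c) a - fderiv ℝ B z.1 a w c + fderiv ℝ B z.1 c w a := by
  have hB' := hasFDerivAt_comp_fst (g := B) (z := z) hB
  have hG' := (hasFDerivAt_comp_fst (g := G) (z := z) hG).differentiableAt
  have e1 : ∀ (b : E) (v : E × E), fderiv ℝ (fun z : E × E =>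
      skewForm (E × E) (liftModel (B z.1) (G z.1 z.2)) ![(0, w), (b, 0)]) z v =
      fderiv ℝ B z.1 v.1 w b := by
    intro b v
    have h1 := (hB'.clm_apply (hasFDerivAt_const w z)).clm_apply (hasFDerivAt_const b z)
    simp only [skewForm_apply, liftModel_apply, Matrix.cons_val_zero, Matrix.cons_val_one,
      map_zero, add_zero, sub_zero]
    rw [h1.fderiv]
    simp
  have e2 : fderiv ℝ (fun z : E × E =>
      skewForm (E × E) (liftModel (B z.1) (G z.1 z.2)) ![(a, 0), (c, 0)]) z (0, w) =
      B z.1 (G z.1 w a) c - B z.1 (G z.1 w c) a := by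
    simp only [skewForm_apply, liftModel_apply, Matrix.cons_val_zero, Matrix.cons_val_one, zero_add]
    have hd : ∀ a c : E, DifferentiableAt ℝ (fun z : E × E => B z.1 (G z.1 z.2 a) c) z :=
      fun a c => (hB'.differentiableAt.clm_apply ((hG'.clm_apply differentiableAt_snd).clm_apply
          (differentiableAt_const _))).clm_apply (differentiableAt_const _)
    have hl : ∀ a c : E, fderiv ℝ (fun z : E × E => B z.1 (G z.1 z.2 a) c) z (0, w) =
        B z.1 (G z.1 w a) c := fun a c => by
      -- The function is linear in `z.2`, hence affine along the line in the direction `(0, w)`.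
      rw [← (hd a c).lineDeriv_eq_fderiv, lineDeriv]
      simp only [Prod.fst_add, Prod.snd_add, Prod.smul_fst, Prod.smul_snd, smul_zero, add_zero,
        map_add, map_smul, add_apply, smul_apply, smul_eq_mul]
      simp
    rw [fderiv_fun_sub (hd a c) (hd c a), sub_apply, hl, hl]
  have r0 : (0 : Fin 3).removeNth ![((0 : E), w), (a, 0), (c, 0)] = ![(a, 0), (c, 0)] := by
    funext i; fin_cases i <;> rfl
  have r1 : (1 : Fin 3).removeNth ![((0 : E), w), (a, 0), (c, 0)] = ![(0, w), (c, 0)] := by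
    funext i; fin_cases i <;> rfl
  have r2 : (2 : Fin 3).removeNth ![((0 : E), w), (a, 0), (c, 0)] = ![(0, w), (a, 0)] := by
    funext i; fin_cases i <;> rfl
  rw [extDeriv_apply hω, Fin.sum_univ_three, r0, r1, r2]
  simp only [Matrix.cons_val_zero, Matrix.cons_val_one, Matrix.cons_val_two, Matrix.tail_cons,
    Matrix.head_cons]
  rw [e1, e1, e2]
  norm_num
  ring

variable [FiniteDimensional ℝ E]
namespace LinearConnection
variable (nabla : LinearConnection E M) (A : Tensor20 E M)

/-- In a chart, the exterior derivative of `A_x(y, dx)` is the lift plus the Codazzi defect. -/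
theorem skewForm_flatPrimitiveDeriv_coord (x₀ : M) (z : E) (y : E) (ζ η : E × E) :
    skewForm (E × E) (flatPrimitiveDeriv (A.coord x₀ z) (fderiv ℝ (A.coord x₀) z) y) ![ζ, η] =
      skewForm (E × E) (liftModel (A.coord x₀ z) (nabla.christoffel x₀ z y)) ![ζ, η] +
        nabla.codazziCoord A x₀ z y ζ.1 η.1 := by
  rw [skewForm_apply, skewForm_apply, codazziCoord]
  simp only [flatPrimitiveDeriv_apply, liftModel_apply, Matrix.cons_val_zero, Matrix.cons_val_one,
    map_add, add_apply]
  ring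

variable {nabla A}

theorem liftForm_inChart_eventuallyEq (p : TangentBundle 𝓘(ℝ, E) M) :
    (nabla.liftForm A).inChart p =ᶠ[𝓝 (extChartAt 𝓘(ℝ, E).tangent p p)] fun z =>
      skewForm (E × E) (liftModel (A.coord p.proj z.1) (nabla.christoffel p.proj z.1 z.2)) := by
  filter_upwards [(isOpen_extChartAt_target p).mem_nhds (mem_extChartAt_target p)] with z hz
  exact nabla.liftForm_inChart A p hz

variable [T2Space M]

theorem Codazzi.d_liftForm (h : nabla.Codazzi A) (hA : A.IsSmooth) : (nabla.liftForm A).d = 0 := by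
  funext p
  set z₀ := extChartAt 𝓘(ℝ, E).tangent p p with hz₀
  have hz₀t : z₀ ∈ (extChartAt 𝓘(ℝ, E).tangent p).target := mem_extChartAt_target p
  have h1 : (nabla.liftForm A).inChart p =ᶠ[𝓝 z₀]
      extDeriv (fun z => oneForm (E × E) (flatPrimitive (A.coord p.proj) z)) := by
    filter_upwards [(isOpen_extChartAt_target p).mem_nhds hz₀t] with z hz
    have hz1 := mem_tangentChart_target.1 hz
    rw [nabla.liftForm_inChart A p hz, extDeriv_oneForm (hasFDerivAt_flatPrimitive
      ((hA.contDiffAt_coord hz1).differentiableAt (by simp)))]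
    refine ContinuousAlternatingMap.ext_fin_two fun ζ η => ?_
    rw [nabla.skewForm_flatPrimitiveDeriv_coord, h.codazziCoord_eq_zero hA hz1, add_zero]
  have h2 : ContDiffAt ℝ ∞ (fun z => oneForm (E × E) (flatPrimitive (A.coord p.proj) z)) z₀ := by
    refine contDiffAt_oneForm (contDiffAt_clm_apply_iff.2 fun ζ => ?_)
    have hA' : ContDiffAt ℝ ∞ (fun z : E × E => A.coord p.proj z.1) z₀ :=
      (hA.contDiffAt_coord (mem_tangentChart_target.1 hz₀t)).comp z₀ contDiffAt_fst
    exact (hA'.clm_apply contDiffAt_snd).clm_apply contDiffAt_const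
  have h3 : extDeriv ((nabla.liftForm A).inChart p) z₀ = 0 := by
    rw [h1.extDeriv_eq]
    refine extDeriv_extDeriv_apply h2 ?_
    rw [minSmoothness_of_isRCLikeNormedField]
    exact WithTop.coe_le_coe.2 (le_top (a := (2 : ℕ∞)))
  rw [DiffForm.d_apply, h3]
  rfl

variable [nabla.ContMDiffCovariantDerivative ∞]

theorem codazzi_of_d_liftForm_eq_zero (hA : A.IsSmooth) (h : (nabla.liftForm A).d = 0) :
    nabla.Codazzi A := by
  refine codazzi_of_codazziCoord_eq_zero hA fun x w a c => ?_
  -- The fibre coordinate of the point of evaluation is irrelevant.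
  let p : TangentBundle 𝓘(ℝ, E) M := ⟨x, 0⟩
  set z₀ := extChartAt 𝓘(ℝ, E).tangent p p with hz₀
  have hz₀t : z₀ ∈ (extChartAt 𝓘(ℝ, E).tangent p).target := mem_extChartAt_target p
  have hz₀1 : z₀.1 = extChartAt 𝓘(ℝ, E) x x := by rw [hz₀, tangentChart_apply]
  have hA' : DifferentiableAt ℝ (A.coord x) z₀.1 :=
    (hA.contDiffAt_coord (mem_tangentChart_target.1 hz₀t)).differentiableAt (by simp)
  have hG' : DifferentiableAt ℝ (nabla.christoffel x) z₀.1 :=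
    (nabla.contDiffAt_christoffel (mem_tangentChart_target.1 hz₀t)).differentiableAt (by simp)
  have hext : extDeriv ((nabla.liftForm A).inChart p) z₀ ![(0, w), (a, 0), (c, 0)] = 0 := by
    have h1 := congr_fun h p
    rw [DiffForm.d_apply] at h1
    have hsurj := (dcoord_bijective (p := p) (u := p) (by simp)).2
    obtain ⟨ξ₁, h₁⟩ := hsurj (0, w)
    obtain ⟨ξ₂, h₂⟩ := hsurj (a, 0)
    obtain ⟨ξ₃, h₃⟩ := hsurj (c, 0)
    have h4 := congr($h1 ![ξ₁, ξ₂, ξ₃])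
    rw [← h₁, ← h₂, ← h₃]
    refine Eq.trans (congr_arg _ ?_) h4
    funext i; fin_cases i <;> rfl
  have hsm := ((isSmooth_liftForm (nabla := nabla) hA p).contDiffAt
    ((isOpen_extChartAt_target p).mem_nhds hz₀t)).differentiableAt (by simp)
  have hev := liftForm_inChart_eventuallyEq (nabla := nabla) (A := A) p
  rw [hev.extDeriv_eq,
    extDeriv_skewForm_liftModel hA' hG' (hev.differentiableAt_iff.1 hsm), hz₀1] at hext
  rw [codazziCoord]
  linear_combination -hext

end LinearConnection

end

/-! ### The Liouville form and the map to the cotangent bundle -/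

section

variable {E : Type*} [NormedAddCommGroup E] [NormedSpace ℝ E]
  {M : Type*} [TopologicalSpace M] [ChartedSpace E M] [IsManifold 𝓘(ℝ, E) ∞ M]
variable {x₀ x : M}

theorem cotangentTrivialization_apply (x₀ : M) (β : CotangentBundle E M) :
    trivializationAt (E →L[ℝ] ℝ) (fun x : M => TangentSpace 𝓘(ℝ, E) x →L[ℝ] ℝ) x₀ β =
      (β.proj, β.2.comp (ofCoord x₀ β.proj)) := by
  refine (hom_trivializationAt_apply (RingHom.id ℝ) x₀ β).trans ?_
  refine Prod.ext rfl ?_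
  change ContinuousLinearMap.inCoordinates E (TangentSpace 𝓘(ℝ, E)) ℝ (Bundle.Trivial M ℝ) x₀ β.proj
    x₀ β.proj β.2 = _
  have h : (trivializationAt ℝ (Bundle.Trivial M ℝ) x₀).continuousLinearMapAt ℝ β.proj =
      ContinuousLinearMap.id ℝ ℝ := Trivial.continuousLinearMapAt_trivialization ..
  rw [ContinuousLinearMap.inCoordinates, h]
  rfl

theorem cotangentChart_apply (α β : CotangentBundle E M) :
    extChartAt (𝓘(ℝ, E).prod 𝓘(ℝ, E →L[ℝ] ℝ)) α β =
      (extChartAt 𝓘(ℝ, E) α.proj β.proj, β.2.comp (ofCoord α.proj β.proj)) := by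
  rw [FiberBundle.extChartAt]
  refine (?_ : _ = Prod.map (extChartAt 𝓘(ℝ, E) α.proj) id (trivializationAt (E →L[ℝ] ℝ)
    (fun x : M => TangentSpace 𝓘(ℝ, E) x →L[ℝ] ℝ) α.proj β)).trans ?_
  · rfl
  · rw [cotangentTrivialization_apply]; rfl

theorem mem_cotangentChart_source {α β : CotangentBundle E M} :
    β ∈ (extChartAt (𝓘(ℝ, E).prod 𝓘(ℝ, E →L[ℝ] ℝ)) α).source ↔
      β.proj ∈ (chartAt E α.proj).source := by
  rw [FiberBundle.extChartAt]
  simp only [hom_trivializationAt_source, mfld_simps]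
  rw [cotangentTrivialization_apply]
  simp

/-- The components of a tangent vector to `T^*M` at `β` in the chart of `T^*M` at `α`, first those
along the base and then those along the fibre. -/
def cotCoord (α β : CotangentBundle E M) :
    TangentSpace (𝓘(ℝ, E).prod 𝓘(ℝ, E →L[ℝ] ℝ)) β →L[ℝ] E × (E →L[ℝ] ℝ) :=
  mfderiv (𝓘(ℝ, E).prod 𝓘(ℝ, E →L[ℝ] ℝ)) 𝓘(ℝ, E × (E →L[ℝ] ℝ))
    (extChartAt (𝓘(ℝ, E).prod 𝓘(ℝ, E →L[ℝ] ℝ)) α) β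

theorem mdifferentiableAt_cotangentChart {α β : CotangentBundle E M}
    (h : β.proj ∈ (chartAt E α.proj).source) :
    MDifferentiableAt (𝓘(ℝ, E).prod 𝓘(ℝ, E →L[ℝ] ℝ)) 𝓘(ℝ, E × (E →L[ℝ] ℝ))
      (extChartAt (𝓘(ℝ, E).prod 𝓘(ℝ, E →L[ℝ] ℝ)) α) β :=
  mdifferentiableAt_extChartAt (by
    rw [← extChartAt_source (𝓘(ℝ, E).prod 𝓘(ℝ, E →L[ℝ] ℝ))]; exact mem_cotangentChart_source.2 h)

theorem cotCoord_fst {α β : CotangentBundle E M} (h : β.proj ∈ (chartAt E α.proj).source)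
    (ξ : TangentSpace (𝓘(ℝ, E).prod 𝓘(ℝ, E →L[ℝ] ℝ)) β) :
    (cotCoord α β ξ).1 = toCoord α.proj β.proj (mfderiv (𝓘(ℝ, E).prod 𝓘(ℝ, E →L[ℝ] ℝ)) 𝓘(ℝ, E)
      (fun β : CotangentBundle E M => β.proj) β ξ) := by
  have hp : MDifferentiableAt (𝓘(ℝ, E).prod 𝓘(ℝ, E →L[ℝ] ℝ)) 𝓘(ℝ, E)
      (fun β : CotangentBundle E M => β.proj) β :=
    (contMDiffAt_proj (n := 1) (fun x : M => TangentSpace 𝓘(ℝ, E) x →L[ℝ] ℝ)).mdifferentiableAt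
      one_ne_zero
  have h1 : HasMFDerivAt (𝓘(ℝ, E).prod 𝓘(ℝ, E →L[ℝ] ℝ)) 𝓘(ℝ, E)
      (Prod.fst ∘ (extChartAt (𝓘(ℝ, E).prod 𝓘(ℝ, E →L[ℝ] ℝ)) α)) β
      ((ContinuousLinearMap.fst ℝ E (E →L[ℝ] ℝ)).comp (cotCoord α β)) :=
    (ContinuousLinearMap.fst ℝ E (E →L[ℝ] ℝ)).hasMFDerivAt.comp β
      (mdifferentiableAt_cotangentChart h).hasMFDerivAt
  have h2 : HasMFDerivAt (𝓘(ℝ, E).prod 𝓘(ℝ, E →L[ℝ] ℝ)) 𝓘(ℝ, E)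
      (extChartAt 𝓘(ℝ, E) α.proj ∘ (fun w : CotangentBundle E M => w.proj)) β
      ((toCoord α.proj β.proj).comp (mfderiv (𝓘(ℝ, E).prod 𝓘(ℝ, E →L[ℝ] ℝ)) 𝓘(ℝ, E)
        (fun β : CotangentBundle E M => β.proj) β) :
        TangentSpace (𝓘(ℝ, E).prod 𝓘(ℝ, E →L[ℝ] ℝ)) β →L[ℝ] E) := by
    have h4 := mfderiv_extChartAt_eq_toCoord h
    exact h4 ▸ (mdifferentiableAt_extChartAt h).hasMFDerivAt.comp β hp.hasMFDerivAt
  have h3 : Prod.fst ∘ (extChartAt (𝓘(ℝ, E).prod 𝓘(ℝ, E →L[ℝ] ℝ)) α) =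
    (extChartAt 𝓘(ℝ, E) α.proj ∘ (fun w : CotangentBundle E M => w.proj)) := by
    funext w; rw [Function.comp_apply, cotangentChart_apply]; rfl
  rw [h3] at h1
  exact congr($(hasMFDerivAt_unique h1 h2) ξ)

theorem cotCoord_symm {α : CotangentBundle E M} {z : E × (E →L[ℝ] ℝ)}
    (hz : z ∈ (extChartAt (𝓘(ℝ, E).prod 𝓘(ℝ, E →L[ℝ] ℝ)) α).target) (ζ : E × (E →L[ℝ] ℝ)) :
    cotCoord α ((extChartAt (𝓘(ℝ, E).prod 𝓘(ℝ, E →L[ℝ] ℝ)) α).symm z)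
      (mfderivWithin 𝓘(ℝ, E × (E →L[ℝ] ℝ)) (𝓘(ℝ, E).prod 𝓘(ℝ, E →L[ℝ] ℝ))
        (extChartAt (𝓘(ℝ, E).prod 𝓘(ℝ, E →L[ℝ] ℝ)) α).symm
        (range (𝓘(ℝ, E).prod 𝓘(ℝ, E →L[ℝ] ℝ))) z ζ) = ζ :=
  congr($(mfderiv_extChartAt_comp_mfderivWithin_extChartAt_symm hz) ζ)

/-- The form `p dq` on `E × E^*`, at the point `z = (q, p)`. -/
def canonicalOneForm (E : Type*) [NormedAddCommGroup E] [NormedSpace ℝ E] :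
    E × (E →L[ℝ] ℝ) →L[ℝ] (E × (E →L[ℝ] ℝ)) →L[ℝ] ℝ :=
  ((ContinuousLinearMap.compL ℝ (E × (E →L[ℝ] ℝ)) E ℝ).flip
    (ContinuousLinearMap.fst ℝ E (E →L[ℝ] ℝ))).comp (ContinuousLinearMap.snd ℝ E (E →L[ℝ] ℝ))

theorem canonicalOneForm_apply (z ζ : E × (E →L[ℝ] ℝ)) : canonicalOneForm E z ζ = z.2 ζ.1 := rfl

theorem liouville_inChart (α : CotangentBundle E M) {z : E × (E →L[ℝ] ℝ)}
    (hz : z ∈ (extChartAt (𝓘(ℝ, E).prod 𝓘(ℝ, E →L[ℝ] ℝ)) α).target) :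
    (liouville E M).inChart α z = oneForm (E × (E →L[ℝ] ℝ)) (canonicalOneForm E z) := by
  have hs := mem_cotangentChart_source.1
    ((extChartAt (𝓘(ℝ, E).prod 𝓘(ℝ, E →L[ℝ] ℝ)) α).map_target hz)
  have key : ∀ (β : CotangentBundle E M), β.proj ∈ (chartAt E α.proj).source →
      extChartAt (𝓘(ℝ, E).prod 𝓘(ℝ, E →L[ℝ] ℝ)) α β = z →
      ∀ (ξ : TangentSpace (𝓘(ℝ, E).prod 𝓘(ℝ, E →L[ℝ] ℝ)) β) (ζ : E × (E →L[ℝ] ℝ)),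
      cotCoord α β ξ = ζ → β.2 (mfderiv (𝓘(ℝ, E).prod 𝓘(ℝ, E →L[ℝ] ℝ)) 𝓘(ℝ, E)
        (fun β : CotangentBundle E M => β.proj) β ξ) = canonicalOneForm E z ζ := by
    intro β hβ hz ξ ζ hζ
    rw [canonicalOneForm_apply, ← hζ, ← hz, cotCoord_fst hβ, cotangentChart_apply,
      ContinuousLinearMap.comp_apply, ofCoord_toCoord hβ]
  ext v
  exact key _ hs ((extChartAt (𝓘(ℝ, E).prod 𝓘(ℝ, E →L[ℝ] ℝ)) α).right_inv hz) _ _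
    (cotCoord_symm hz (v 0))

theorem d_liouville_apply (α : CotangentBundle E M)
    (ξ η : TangentSpace (𝓘(ℝ, E).prod 𝓘(ℝ, E →L[ℝ] ℝ)) α) :
    (liouville E M).d α ![ξ, η] =
      (cotCoord α α ξ).2 (cotCoord α α η).1 - (cotCoord α α η).2 (cotCoord α α ξ).1 := by
  set z := extChartAt (𝓘(ℝ, E).prod 𝓘(ℝ, E →L[ℝ] ℝ)) α α
  have h1 : (liouville E M).inChart α =ᶠ[𝓝 z]
      fun z => oneForm (E × (E →L[ℝ] ℝ)) (canonicalOneForm E z) := by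
    filter_upwards [(isOpen_extChartAt_target α).mem_nhds (mem_extChartAt_target α)] with z hz
    exact liouville_inChart α hz
  rw [DiffForm.d_apply, h1.extDeriv_eq, extDeriv_oneForm (canonicalOneForm E).hasFDerivAt]
  exact skewForm_apply _ _

variable [FiniteDimensional ℝ E] {A : Tensor20 E M}

theorem Tensor20.IsSmooth.flat_snd_hasMFDerivAt (hA : A.IsSmooth) (u : TangentBundle 𝓘(ℝ, E) M) :
    HasMFDerivAt 𝓘(ℝ, E).tangent 𝓘(ℝ, E →L[ℝ] ℝ) (fun w : TangentBundle 𝓘(ℝ, E) M =>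
      (A.flat w).2.comp (ofCoord u.proj w.proj) : TangentBundle 𝓘(ℝ, E) M → E →L[ℝ] ℝ) u
      (((A.coord u.proj (extChartAt 𝓘(ℝ, E) u.proj u.proj)).comp (ContinuousLinearMap.snd ℝ E E) +
        ((fderiv ℝ (A.coord u.proj) (extChartAt 𝓘(ℝ, E) u.proj u.proj)).comp
          (ContinuousLinearMap.fst ℝ E E)).flip (toCoord u.proj u.proj u.2)).comp (dcoord u u)) := by
  have hu : u.proj ∈ (chartAt E u.proj).source := by simp
  have hz : (extChartAt 𝓘(ℝ, E).tangent u u).1 ∈ (extChartAt 𝓘(ℝ, E) u.proj).target :=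
    mem_tangentChart_target.1 (mem_extChartAt_target (I := 𝓘(ℝ, E).tangent) u)
  have h0 : extChartAt 𝓘(ℝ, E).tangent u u =
      (extChartAt 𝓘(ℝ, E) u.proj u.proj, toCoord u.proj u.proj u.2) := by
    rw [tangentChart_apply, trivializationAt_snd hu]
  have hB := hasFDerivAt_comp_fst (g := A.coord u.proj) (z := extChartAt 𝓘(ℝ, E).tangent u u)
    ((hA.contDiffAt_coord hz).differentiableAt (by simp))
  have h1 := hB.clm_apply (hasFDerivAt_snd (𝕜 := ℝ) (E := E) (F := E))
  have h2 := h1.hasMFDerivAt.comp u (mdifferentiableAt_tangentChart hu).hasMFDerivAt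
  rw [h0] at h2
  refine h2.congr_of_eventuallyEq ?_
  have := (FiberBundle.continuous_proj E (TangentSpace 𝓘(ℝ, E) : M → Type _)).continuousAt
    (x := u) ((chartAt E u.proj).open_source.mem_nhds hu)
  filter_upwards [this] with w hw
  ext v
  rw [Function.comp_apply, tangentChart_apply, trivializationAt_snd hw]
  conv_rhs => rw [← toCoord_ofCoord hw v]
  exact (A.coord_toCoord hw _ _).symm

theorem Tensor20.IsSmooth.mdifferentiableAt_flat (hA : A.IsSmooth) (u : TangentBundle 𝓘(ℝ, E) M) :
    MDifferentiableAt 𝓘(ℝ, E).tangent (𝓘(ℝ, E).prod 𝓘(ℝ, E →L[ℝ] ℝ)) A.flat u := by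
  rw [mdifferentiableAt_totalSpace]
  refine ⟨mdifferentiableAt_proj u, ?_⟩
  refine (hA.flat_snd_hasMFDerivAt u).mdifferentiableAt.congr_of_eventuallyEq
    (Filter.Eventually.of_forall fun w => ?_)
  exact congr_arg Prod.snd (cotangentTrivialization_apply _ _)

theorem Tensor20.IsSmooth.cotCoord_mfderiv_flat (hA : A.IsSmooth) (u : TangentBundle 𝓘(ℝ, E) M)
    (ξ : TangentSpace 𝓘(ℝ, E).tangent u) :
    cotCoord (A.flat u) (A.flat u)
      (mfderiv 𝓘(ℝ, E).tangent (𝓘(ℝ, E).prod 𝓘(ℝ, E →L[ℝ] ℝ)) A.flat u ξ) =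
      ((dcoord u u ξ).1, A.coord u.proj (extChartAt 𝓘(ℝ, E) u.proj u.proj) (dcoord u u ξ).2 +
        fderiv ℝ (A.coord u.proj) (extChartAt 𝓘(ℝ, E) u.proj u.proj) (dcoord u u ξ).1
          (toCoord u.proj u.proj u.2)) := by
  have hu : u.proj ∈ (chartAt E u.proj).source := by simp
  have hα : (A.flat u).proj ∈ (chartAt E (A.flat u).proj).source := by simp
  have h1 := (mdifferentiableAt_cotangentChart hα).hasMFDerivAt.comp u
    (hA.mdifferentiableAt_flat u).hasMFDerivAt
  have h2 : HasMFDerivAt 𝓘(ℝ, E).tangent 𝓘(ℝ, E)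
      (fun w : TangentBundle 𝓘(ℝ, E) M => extChartAt 𝓘(ℝ, E) u.proj w.proj) u
      ((ContinuousLinearMap.fst ℝ E E).comp (dcoord u u)) := by
    have h3 : HasMFDerivAt 𝓘(ℝ, E).tangent 𝓘(ℝ, E)
        (Prod.fst ∘ (extChartAt 𝓘(ℝ, E).tangent u)) u
        ((ContinuousLinearMap.fst ℝ E E).comp (dcoord u u)) :=
      (ContinuousLinearMap.fst ℝ E E).hasMFDerivAt.comp u
        (mdifferentiableAt_tangentChart hu).hasMFDerivAt
    exact h3.congr_of_eventuallyEq (Filter.Eventually.of_forall fun w => by simp)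
  have h5 := hA.flat_snd_hasMFDerivAt u
  have h3 : HasMFDerivAt 𝓘(ℝ, E).tangent 𝓘(ℝ, E × (E →L[ℝ] ℝ))
      (fun w : TangentBundle 𝓘(ℝ, E) M => (extChartAt 𝓘(ℝ, E) u.proj w.proj,
        ((A.flat w).2.comp (ofCoord u.proj w.proj) : E →L[ℝ] ℝ))) u _ :=
    ⟨h2.1.prodMk h5.1, h2.2.prodMk h5.2⟩
  have h4 := h3.congr_of_eventuallyEq (f₁ := extChartAt (𝓘(ℝ, E).prod 𝓘(ℝ, E →L[ℝ] ℝ)) (A.flat u) ∘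
    A.flat) (Filter.Eventually.of_forall fun w => cotangentChart_apply _ _)
  exact congr($(hasMFDerivAt_unique h1 h4) ξ)

end

/-! ### The four conditions -/

section

variable {E : Type*} [NormedAddCommGroup E] [NormedSpace ℝ E]
  {M : Type*} [TopologicalSpace M] [ChartedSpace E M] [IsManifold 𝓘(ℝ, E) ∞ M]
variable {x₀ x : M}
variable [FiniteDimensional ℝ E] {nabla : LinearConnection E M} {A : Tensor20 E M}

/-- The forms `(A♭)^*(dλ)` and `Ω` differ by the Codazzi defect. -/
theorem Tensor20.IsSmooth.d_liouville_mfderiv_flat (hA : A.IsSmooth) (nabla : LinearConnection E M)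
    (u : TangentBundle 𝓘(ℝ, E) M) (ξ η : TangentSpace 𝓘(ℝ, E).tangent u) :
    (liouville E M).d (A.flat u)
      ![mfderiv 𝓘(ℝ, E).tangent (𝓘(ℝ, E).prod 𝓘(ℝ, E →L[ℝ] ℝ)) A.flat u ξ,
        mfderiv 𝓘(ℝ, E).tangent (𝓘(ℝ, E).prod 𝓘(ℝ, E →L[ℝ] ℝ)) A.flat u η] =
      nabla.liftForm A u ![ξ, η] + nabla.codazziCoord A u.proj (extChartAt 𝓘(ℝ, E) u.proj u.proj)
        (toCoord u.proj u.proj u.2) (dcoord u u ξ).1 (dcoord u u η).1 := by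
  have h1 := nabla.skewForm_flatPrimitiveDeriv_coord A u.proj (extChartAt 𝓘(ℝ, E) u.proj u.proj)
    (toCoord u.proj u.proj u.2) (dcoord u u ξ) (dcoord u u η)
  have h2 : nabla.liftForm A u ![ξ, η] = skewForm (E × E)
      (liftModel (A.coord u.proj (extChartAt 𝓘(ℝ, E) u.proj u.proj))
      (nabla.christoffel u.proj (extChartAt 𝓘(ℝ, E) u.proj u.proj) (toCoord u.proj u.proj u.2)))
      ![dcoord u u ξ, dcoord u u η] := by
    refine congr_arg (skewForm (E × E) _) ?_
    funext i; fin_cases i <;> rfl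
  rw [h2, ← h1, d_liouville_apply, hA.cotCoord_mfderiv_flat, hA.cotCoord_mfderiv_flat,
    skewForm_apply]
  rfl

theorem Tensor20.IsSmooth.pullback_d_liouville_apply (hA : A.IsSmooth)
    (nabla : LinearConnection E M) (u : TangentBundle 𝓘(ℝ, E) M)
    (ξ η : TangentSpace 𝓘(ℝ, E).tangent u) :
    (liouville E M).d.pullback 𝓘(ℝ, E).tangent (𝓘(ℝ, E).prod 𝓘(ℝ, E →L[ℝ] ℝ)) A.flat u ![ξ, η] =
      nabla.liftForm A u ![ξ, η] + nabla.codazziCoord A u.proj (extChartAt 𝓘(ℝ, E) u.proj u.proj)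
        (toCoord u.proj u.proj u.2) (dcoord u u ξ).1 (dcoord u u η).1 := by
  rw [← hA.d_liouville_mfderiv_flat nabla]
  refine congr_arg ((liouville E M).d (A.flat u)) ?_
  funext i; fin_cases i <;> rfl

namespace LinearConnection

theorem codazzi_of_forall_tangent (hA : A.IsSmooth)
    (h : ∀ (u : TangentBundle 𝓘(ℝ, E) M) (v w : TangentSpace 𝓘(ℝ, E) u.proj),
      nabla.codazziCoord A u.proj (extChartAt 𝓘(ℝ, E) u.proj u.proj) (toCoord u.proj u.proj u.2)
        (toCoord u.proj u.proj v) (toCoord u.proj u.proj w) = 0) : nabla.Codazzi A := by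
  refine codazzi_of_codazziCoord_eq_zero hA fun x y a c => ?_
  have := h ⟨x, ofCoord x x y⟩ (ofCoord x x a) (ofCoord x x c)
  rwa [toCoord_ofCoord (mem_chart_source E x), toCoord_ofCoord (mem_chart_source E x),
    toCoord_ofCoord (mem_chart_source E x)] at this

variable (nabla) in
/-- Existence of horizontal lifts. -/
theorem exists_connector_eq_zero (u : TangentBundle 𝓘(ℝ, E) M) (v : TangentSpace 𝓘(ℝ, E) u.proj) :
    ∃ ξ : TangentSpace 𝓘(ℝ, E).tangent u, nabla.connector u ξ = 0 ∧ dproj u ξ = v := by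
  obtain ⟨ξ, hξ⟩ := (nabla.dproj_connector_bijective u).2 (v, 0)
  exact ⟨ξ, congr($hξ.2), congr($hξ.1)⟩

theorem liftForm_eq_zero_of_connector_eq_zero {u : TangentBundle 𝓘(ℝ, E) M}
    {ξ η : TangentSpace 𝓘(ℝ, E).tangent u} (hξ : nabla.connector u ξ = 0)
    (hη : nabla.connector u η = 0) : nabla.liftForm A u ![ξ, η] = 0 := by
  rw [liftForm_apply, hξ, hη, map_zero]
  exact sub_zero _

theorem codazzi_of_horizontal_isotropic (hA : A.IsSmooth)
    (h : ∀ (u : TangentBundle 𝓘(ℝ, E) M) (ξ η : TangentSpace 𝓘(ℝ, E).tangent u),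
      nabla.connector u ξ = 0 → nabla.connector u η = 0 →
        (liouville E M).d (A.flat u)
      ![mfderiv 𝓘(ℝ, E).tangent (𝓘(ℝ, E).prod 𝓘(ℝ, E →L[ℝ] ℝ)) A.flat u ξ,
        mfderiv 𝓘(ℝ, E).tangent (𝓘(ℝ, E).prod 𝓘(ℝ, E →L[ℝ] ℝ)) A.flat u η] = 0) :
    nabla.Codazzi A := by
  refine codazzi_of_forall_tangent hA fun u v w => ?_
  have hu : u.proj ∈ (chartAt E u.proj).source := by simp
  obtain ⟨ξ, hξ, hξ'⟩ := nabla.exists_connector_eq_zero u v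
  obtain ⟨η, hη, hη'⟩ := nabla.exists_connector_eq_zero u w
  have h1 := h u ξ η hξ hη
  rw [hA.d_liouville_mfderiv_flat nabla, liftForm_eq_zero_of_connector_eq_zero hξ hη, zero_add,
    dcoord_fst hu, dcoord_fst hu, hξ', hη'] at h1
  exact h1

theorem codazzi_of_liftForm_eq_pullback (hA : A.IsSmooth) (h : nabla.liftForm A =
      (liouville E M).d.pullback 𝓘(ℝ, E).tangent (𝓘(ℝ, E).prod 𝓘(ℝ, E →L[ℝ] ℝ)) A.flat) :
    nabla.Codazzi A := by
  refine codazzi_of_forall_tangent hA fun u v w => ?_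
  have hu : u.proj ∈ (chartAt E u.proj).source := by simp
  obtain ⟨ξ, -, hξ'⟩ := nabla.exists_connector_eq_zero u v
  obtain ⟨η, -, hη'⟩ := nabla.exists_connector_eq_zero u w
  have h1 := hA.pullback_d_liouville_apply nabla u ξ η
  rw [← h, dcoord_fst hu, dcoord_fst hu, hξ', hη'] at h1
  exact left_eq_add.1 h1

variable [T2Space M]

theorem Codazzi.liftForm_eq_pullback (h : nabla.Codazzi A) (hA : A.IsSmooth) : nabla.liftForm A =
      (liouville E M).d.pullback 𝓘(ℝ, E).tangent (𝓘(ℝ, E).prod 𝓘(ℝ, E →L[ℝ] ℝ)) A.flat := by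
  funext u
  refine ContinuousAlternatingMap.ext_fin_two fun ξ η => ?_
  rw [hA.pullback_d_liouville_apply nabla, h.codazziCoord_eq_zero hA (mem_extChartAt_target _),
    add_zero]

theorem Codazzi.d_liouville_mfderiv_flat (h : nabla.Codazzi A) (hA : A.IsSmooth)
    (u : TangentBundle 𝓘(ℝ, E) M) (ξ η : TangentSpace 𝓘(ℝ, E).tangent u) :
    (liouville E M).d (A.flat u)
      ![mfderiv 𝓘(ℝ, E).tangent (𝓘(ℝ, E).prod 𝓘(ℝ, E →L[ℝ] ℝ)) A.flat u ξ,
        mfderiv 𝓘(ℝ, E).tangent (𝓘(ℝ, E).prod 𝓘(ℝ, E →L[ℝ] ℝ)) A.flat u η] =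
      nabla.liftForm A u ![ξ, η] := by
  rw [hA.d_liouville_mfderiv_flat nabla, h.codazziCoord_eq_zero hA (mem_extChartAt_target _),
    add_zero]

/-- Under the Codazzi equation `(A♭)^*(dλ)` is the nondegenerate form `Ω`, so the differentials of
`A♭` are injective, and a count of dimensions gives surjectivity. -/
theorem Codazzi.mfderiv_flat_surjective (h : nabla.Codazzi A) (hA : A.IsSmooth)
    (hA' : A.Nondegenerate) (u : TangentBundle 𝓘(ℝ, E) M) :
    Function.Surjective (mfderiv 𝓘(ℝ, E).tangent (𝓘(ℝ, E).prod 𝓘(ℝ, E →L[ℝ] ℝ)) A.flat u) := by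
  have hinj : ∀ ξ, mfderiv 𝓘(ℝ, E).tangent (𝓘(ℝ, E).prod 𝓘(ℝ, E →L[ℝ] ℝ)) A.flat u ξ = 0 →
      ξ = 0 := fun ξ hξ => liftForm_nondegenerate (nabla := nabla) hA' fun η => by
    rw [← h.d_liouville_mfderiv_flat hA, hξ]
    exact ((liouville E M).d (A.flat u)).map_coord_zero 0 rfl
  have key : ∀ L : E × E →L[ℝ] E × (E →L[ℝ] ℝ), (∀ ξ, L ξ = 0 → ξ = 0) →
      Function.Surjective L := fun L hL => by
    have hdim : Module.finrank ℝ (E × E) = Module.finrank ℝ (E × (E →L[ℝ] ℝ)) := by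
      rw [Module.finrank_prod, Module.finrank_prod,
        ← (LinearMap.toContinuousLinearMap (𝕜 := ℝ) (E := E) (F' := ℝ)).finrank_eq]
      exact congr_arg _ Subspace.dual_finrank_eq.symm
    exact (LinearMap.injective_iff_surjective_of_finrank_eq_finrank (f := L.toLinearMap) hdim).1
      ((injective_iff_map_eq_zero _).2 hL)
  exact key _ hinj

variable [nabla.ContMDiffCovariantDerivative ∞]

theorem mem_image_horizontal_iff (hA' : A.Nondegenerate) {u : TangentBundle 𝓘(ℝ, E) M}
    {ζ : TangentSpace (𝓘(ℝ, E).prod 𝓘(ℝ, E →L[ℝ] ℝ)) (A.flat u)} :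
    (⟨A.flat u, ζ⟩ : TangentBundle (𝓘(ℝ, E).prod 𝓘(ℝ, E →L[ℝ] ℝ)) (CotangentBundle E M)) ∈
        tangentMap 𝓘(ℝ, E).tangent (𝓘(ℝ, E).prod 𝓘(ℝ, E →L[ℝ] ℝ)) A.flat '' nabla.horizontal ↔
      ∃ ξ : TangentSpace 𝓘(ℝ, E).tangent u, nabla.connector u ξ = 0 ∧
        mfderiv 𝓘(ℝ, E).tangent (𝓘(ℝ, E).prod 𝓘(ℝ, E →L[ℝ] ℝ)) A.flat u ξ = ζ := by
  constructor
  · rintro ⟨⟨w, ξ⟩, hξ, h⟩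
    have hflat : A.flat w = A.flat u := congr_arg TotalSpace.proj h
    have hw : w = u := by
      -- `A♭` is injective.
      obtain ⟨y, v⟩ := w
      obtain ⟨x, v'⟩ := u
      obtain rfl : y = x := congr_arg TotalSpace.proj hflat
      have h2 : A y v = A y v' := eq_of_heq (TotalSpace.mk.inj hflat).2
      rw [(hA'.bijective y).1 h2]
    subst hw
    exact ⟨ξ, nabla.mem_horizontalAt_iff.1 hξ, eq_of_heq (TotalSpace.mk.inj h).2⟩
  · rintro ⟨ξ, hξ, rfl⟩
    exact ⟨⟨u, ξ⟩, nabla.mem_horizontalAt_iff.2 hξ, rfl⟩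

theorem isLagrangian_iff_codazzi (hA : A.IsSmooth) (hA' : A.Nondegenerate) :
    (liouville E M).d.IsLagrangian
      (tangentMap 𝓘(ℝ, E).tangent (𝓘(ℝ, E).prod 𝓘(ℝ, E →L[ℝ] ℝ)) A.flat '' nabla.horizontal) ↔
      nabla.Codazzi A := by
  constructor
  · intro h
    exact codazzi_of_horizontal_isotropic hA fun u ξ η hξ hη =>
      (h (A.flat u) _).1 ((mem_image_horizontal_iff hA').2 ⟨ξ, hξ, rfl⟩) _
        ((mem_image_horizontal_iff hA').2 ⟨η, hη, rfl⟩)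
  · intro h α ζ
    obtain ⟨u, rfl⟩ : ∃ u : TangentBundle 𝓘(ℝ, E) M, A.flat u = α := by
      obtain ⟨x, f⟩ := α
      obtain ⟨v, rfl⟩ := (hA'.bijective x).2 f
      exact ⟨⟨x, v⟩, rfl⟩
    obtain ⟨ξ, rfl⟩ := h.mfderiv_flat_surjective hA hA' u ζ
    constructor
    · intro hζ η hη
      obtain ⟨ξ', hξ', h1⟩ := (mem_image_horizontal_iff hA').1 hζ
      obtain ⟨η', hη', rfl⟩ := (mem_image_horizontal_iff hA').1 hη
      rw [← h1, h.d_liouville_mfderiv_flat hA]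
      exact liftForm_eq_zero_of_connector_eq_zero hξ' hη'
    · intro hζ
      refine (mem_image_horizontal_iff hA').2 ⟨ξ, hA' _ _ fun v => ?_, rfl⟩
      obtain ⟨η, hη, rfl⟩ := nabla.exists_connector_eq_zero u v
      have h1 := hζ _ ((mem_image_horizontal_iff hA').2 ⟨η, hη, rfl⟩)
      rw [h.d_liouville_mfderiv_flat hA, liftForm_apply, hη, map_zero] at h1
      exact (sub_zero _).symm.trans h1

theorem isSymplectic_liftForm_iff_codazzi (hA : A.IsSmooth) (hA' : A.Nondegenerate) :
    (nabla.liftForm A).IsSymplectic ↔ nabla.Codazzi A :=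
  ⟨fun h => codazzi_of_d_liftForm_eq_zero hA h.closed, fun h =>
    ⟨isSmooth_liftForm hA, h.d_liftForm hA, fun _ _ => liftForm_nondegenerate hA'⟩⟩

end LinearConnection

end

end

theorem mainTheorem2 {E : Type*} [NormedAddCommGroup E] [NormedSpace ℝ E] [FiniteDimensional ℝ E]
    {M : Type*} [TopologicalSpace M] [T2Space M] [ChartedSpace E M] [IsManifold 𝓘(ℝ, E) ∞ M]
    (nabla : LinearConnection E M) [nabla.ContMDiffCovariantDerivative ∞]
    (A : Tensor20 E M) (hA : A.IsSmooth) (hA' : A.Nondegenerate) :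
    (∃! Ω : DiffForm 𝓘(ℝ, E).tangent (TangentBundle 𝓘(ℝ, E) M) 2, nabla.IsLift 0 0 A Ω) ∧
    ∀ Ω : DiffForm 𝓘(ℝ, E).tangent (TangentBundle 𝓘(ℝ, E) M) 2, nabla.IsLift 0 0 A Ω →
      List.TFAE [
        nabla.Codazzi A,
        Ω = (liouville E M).d.pullback 𝓘(ℝ, E).tangent (𝓘(ℝ, E).prod 𝓘(ℝ, E →L[ℝ] ℝ)) A.flat,
        Ω.IsSymplectic,
        (liouville E M).d.IsLagrangian
          (tangentMap 𝓘(ℝ, E).tangent (𝓘(ℝ, E).prod 𝓘(ℝ, E →L[ℝ] ℝ)) A.flat ''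
            nabla.horizontal)] := by
  refine ⟨⟨nabla.liftForm A, nabla.isLift_liftForm A, fun Ω hΩ => hΩ.eq_liftForm⟩, fun Ω hΩ => ?_⟩
  rw [hΩ.eq_liftForm]
  tfae_have 1 → 2 := fun h => h.liftForm_eq_pullback hA
  tfae_have 2 → 1 := LinearConnection.codazzi_of_liftForm_eq_pullback hA
  tfae_have 3 ↔ 1 := LinearConnection.isSymplectic_liftForm_iff_codazzi hA hA'
  tfae_have 4 ↔ 1 := LinearConnection.isLagrangian_iff_codazzi hA hA'
  tfae_finish
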